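/- **Setting.** Let $k\ge 1$, let $\tau:E\to Q$ be a smooth real vector bundle of rank $m$ over a smooth $n$-dimensional manifold $Q$ (Hausdorff, second countable), and let $([\cdot,\cdot]_E,\rho)$ be a Lie algebroid structure on $E$: a real Lie bracket on $\mathrm{Sec}(E)$ and a smooth bundle map $\rho:E\to TQ$ over the identity with $[\sigma,f\tau]_E=f[\sigma,\tau]_E+(\rho(\sigma)f)\tau$. Put $M=\mathbb R^k\times\oplus^kE^*$, with points $(t,b)=(t,b_1,\dots,b_k)$, and let $\pi:M\to Q$ be the projection. The prolongation $\mathcal T^EM\to M$ has fibre $\{(a,v)\in E_{\pi(p)}\times T_pM:\rho(a)=T_p\pi(v)\}$ at $p$; it is a Lie algebroid over $M$ with anchor $(a,v)\mapsto v$ and with bracket determined by $[(\sigma\circ\pi,X),(\sigma'\circ\pi,X')]=([\sigma,\sigma']_E\circ\pi,[X,X'])$ on projectable sections. The $k$-prolongation $\mathcal T^E_k(\oplus^kE^*)\to M$ has as fibre at $p$ the tuples $z=(a_A,v_A)_{A=1}^k$ with each $(a_A,v_A)\in\mathcal T^E_pM$; brackets of its projectable sections are taken componentwise. For $1\le A\le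 k$, $d^A$ is given by the Koszul formula with the action $Z\mapsto v_A$ on functions and this bracket; in particular $d^Af(z)=v_A(f)$. Let $$\Theta^A_{(t,b)}(z)=b_A(a_A),\qquad \Omega^A=-d^A\Theta^A,\qquad \overline{\mathcal Y}{}^C_A(z)=dt^C(v_A).$$ **Hypotheses.** Let $H:M\to\mathbb R$ be smooth and let $\xi$ be a smooth section of $\mathcal T^E_k(\oplus^kE^*)\to M$ such that, for all $A,C$, $$\overline{\mathcal Y}{}^C_A(\xi)=\delta^C_A,\qquad \imath_\xi\Omega^A=\frac1k\Big(d^AH-\sum_{B=1}^k\frac{\partial H}{\partial t^B}\,\overline{\mathcal Y}{}^B_A\Big);$$ or, more generally, such that the first equation holds and the second one holds after summation over $A$, on all diagonal elements $z$, i.e. those with $(a_1,v_1)=\dots=(a_k,v_k)$. Let $\psi=(\overline\psi,\underline\psi)$ be a morphism of Lie algebroids from $T\mathbb R^k\to\mathbb R^k$ to $\mathcal T^EM\to M$ (a smooth vector bundle map whose pull-back of forms commutes with the exterior differentials in every degree) such that $\underline\psi:\mathbb R^k\to M$ is an integral section of $\xi$, that is, $T_t\underline\psi(\partial/\partial t^A)$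 is the $A$-th tangent vector of $\xi(\underline\psi(t))$ for all $t$ and $A$. **Conclusion.** Let $(q^i)$ be a chart of $Q$ with domain $U$, $\{e_\alpha\}$ a local basis of smooth sections of $E$ over $U$, with structure functions given by $\rho(e_\alpha)=\rho^i_\alpha\,\partial/\partial q^i$ and $[e_\alpha,e_\beta]_E=\mathcal C^\gamma_{\alpha\beta}e_\gamma$, and let $(t^A,q^i,y^A_\alpha)$, with $y^A_\alpha(t,b)=b_A(e_\alpha)$, be the induced coordinates on $\pi^{-1}(U)$. Put $\psi^i=q^i\circ\underline\psi$, $\psi^A_\alpha=y^A_\alpha\circ\underline\psi$, and let $\psi^\alpha_A$ and $\psi^B_{\beta A}$ be the coefficients of $\overline\psi(\partial/\partial t^A)$ along $\mathcal X_\alpha=(e_\alpha,\rho^i_\alpha\,\partial/\partial q^i)$ and $\mathcal V^\beta_B=(0,\partial/\partial y^B_\beta)$. Then at every $t$ with $\pi(\underline\psi(t))\in U$, for all values of the free indices (sums over repeated Latin lower-case and Greek indices), $$\frac{\partial\psi^i}{\partial t^A}=\rho^i_\alpha\frac{\partial H}{\partial y^A_\alpha}\Big|_{\underline\psi(t)},\qquad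 \sum_{A=1}^k\frac{\partial\psi^A_\beta}{\partial t^A}=-\Big(\rho^i_\beta\frac{\partial H}{\partial q^i}\Big|_{\underline\psi(t)}+\sum_{A=1}^k\mathcal C^\gamma_{\beta\alpha}\,\psi^A_\gamma(t)\,\frac{\partial H}{\partial y^A_\alpha}\Big|_{\underline\psi(t)}\Big),$$ $$\rho^i_\alpha\psi^\alpha_A=\frac{\partial\psi^i}{\partial t^A},\qquad \psi^B_{\beta A}=\frac{\partial\psi^B_\beta}{\partial t^A},\qquad 0=\frac{\partial\psi^\alpha_A}{\partial t^B}-\frac{\partial\psi^\alpha_B}{\partial t^A}+\mathcal C^\alpha_{\beta\gamma}\,\psi^\beta_B\,\psi^\gamma_A,$$ where $\rho^i_\alpha$ and $\mathcal C^\gamma_{\alpha\beta}$ are evaluated at $\pi(\underline\psi(t))$. -/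

import Mathlib

open Set Bundle Topology
open scoped Manifold ContDiff

noncomputable section

/-! ## Lie algebroids -/

section Algebroid

variable {HB : Type*} [TopologicalSpace HB] {EB : Type*} [NormedAddCommGroup EB] [NormedSpace ℝ EB]
  (I : ModelWithCorners ℝ EB HB) {Q : Type*} [TopologicalSpace Q] [ChartedSpace HB Q]
  (F : Type*) [NormedAddCommGroup F] [NormedSpace ℝ F]
  (E : Q → Type*) [∀ q, AddCommGroup (E q)] [∀ q, Module ℝ (E q)] [∀ q, TopologicalSpace (E q)]
  [∀ q, IsTopologicalAddGroup (E q)] [∀ q, ContinuousSMul ℝ (E q)]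
  [TopologicalSpace (TotalSpace F E)] [FiberBundle F E] [VectorBundle ℝ F E]

/-- The derivative `v f` of a real function `f` along a tangent vector `v` at `q`. -/
def dirDeriv {I : ModelWithCorners ℝ EB HB} (f : Q → ℝ) (q : Q) (v : TangentSpace I q) : ℝ :=
  mfderiv I 𝓘(ℝ, ℝ) f q v

/-- A Lie algebroid structure on the smooth vector bundle `E → Q`: a real Lie bracket on the smooth
sections and a smooth bundle map `E → TQ` over the identity (the anchor), with the Leibniz rule
`[σ, f τ] = f [σ, τ] + (ρ(σ) f) τ`. -/
structure LieAlgebroid [IsManifold I ∞ Q] [ContMDiffVectorBundle ∞ F E I] where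
  bracket : Cₛ^∞⟮I; F, E⟯ →ₗ[ℝ] Cₛ^∞⟮I; F, E⟯ →ₗ[ℝ] Cₛ^∞⟮I; F, E⟯
  bracket_self : ∀ σ, bracket σ σ = 0
  jacobi : ∀ σ τ υ,
    bracket σ (bracket τ υ) + bracket τ (bracket υ σ) + bracket υ (bracket σ τ) = 0
  anchor : ∀ q, E q →L[ℝ] TangentSpace I q
  anchor_smooth : ContMDiff (I.prod 𝓘(ℝ, F)) I.tangent ∞
    (fun a : TotalSpace F E => (⟨a.proj, anchor a.proj a.2⟩ : TangentBundle I Q))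
  leibniz : ∀ (σ τ υ : Cₛ^∞⟮I; F, E⟯) (f : Q → ℝ), ContMDiff I 𝓘(ℝ, ℝ) ∞ f →
    (∀ q, υ q = f q • τ q) → ∀ q,
      bracket σ υ q = f q • bracket σ τ q + dirDeriv f q (anchor q (σ q)) • τ q

end Algebroid

/-- The Koszul expression
`∑ᵢ (-1)ⁱ D(Zᵢ) μ(…, Ẑᵢ, …) + ∑_{i<j} (-1)ⁱ⁺ʲ μ([Zᵢ, Zⱼ], …, Ẑᵢ, …, Ẑⱼ, …)`
(indices from `0`) at `p`, for sections of a type `S` with bracket `br`, acting on functions by `D`.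
The bracket is put in the `i`-th slot instead of the first one, which turns the sign `(-1)ⁱ⁺ʲ`
into `(-1)ʲ`. -/
def koszul {S M : Type*} (D : S → (M → ℝ) → M → ℝ) (br : S → S → S) {l : ℕ}
    (μ : (Fin l → S) → M → ℝ) (Z : Fin (l + 1) → S) (p : M) : ℝ :=
  ∑ i : Fin (l + 1), (-1) ^ (i : ℕ) * D (Z i) (μ (i.removeNth Z)) p +
  ∑ j : Fin (l + 1), ∑ i : Fin l, if i.castSucc < j then
    (-1) ^ (j : ℕ) * μ (Function.update (j.removeNth Z) i (br (Z i.castSucc) (Z j))) p else 0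

/-! ## Prolongations of a Lie algebroid over a fibration `pr : M → Q` -/

section Prolongation

variable {HB : Type*} [TopologicalSpace HB] {EB : Type*} [NormedAddCommGroup EB] [NormedSpace ℝ EB]
  {I : ModelWithCorners ℝ EB HB} {Q : Type*} [TopologicalSpace Q] [ChartedSpace HB Q]
  {F : Type*} [NormedAddCommGroup F] [NormedSpace ℝ F]
  {E : Q → Type*} [∀ q, AddCommGroup (E q)] [∀ q, Module ℝ (E q)] [∀ q, TopologicalSpace (E q)]
  [∀ q, IsTopologicalAddGroup (E q)] [∀ q, ContinuousSMul ℝ (E q)]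
  [TopologicalSpace (TotalSpace F E)] [FiberBundle F E] [VectorBundle ℝ F E]
  [IsManifold I ∞ Q] [ContMDiffVectorBundle ∞ F E I]
  (L : LieAlgebroid I F E)
  {HM : Type*} [TopologicalSpace HM] {EM : Type*} [NormedAddCommGroup EM] [NormedSpace ℝ EM]
  (IM : ModelWithCorners ℝ EM HM) {M : Type*} [TopologicalSpace M] [ChartedSpace HM M]
  [IsManifold IM ∞ M] (pr : M → Q)

/-- The fibre at `p` of the prolongation `T^E M`: the pairs `(a, v)` in `E_{pr p} × T_p M`
with `ρ(a) = T pr (v)`. -/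
abbrev ProlongFiber (p : M) : Submodule ℝ (E (pr p) × TangentSpace IM p) :=
  LinearMap.eqLocus
    ((L.anchor (pr p)).toLinearMap ∘ₗ LinearMap.fst ℝ (E (pr p)) (TangentSpace IM p))
    ((mfderiv IM I pr p).toLinearMap ∘ₗ LinearMap.snd ℝ (E (pr p)) (TangentSpace IM p))

/-- Pairs of a section `σ` of `E` and a vector field `X` on `M`. Such a pair defines the projectable
section `p ↦ (σ (pr p), X p)` of `T^E M` wherever `X` is related to `ρ(σ)`. -/
abbrev PreSection (I : ModelWithCorners ℝ EB HB) (F : Type*) [NormedAddCommGroup F]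
    [NormedSpace ℝ F] (E : Q → Type*) [∀ q, AddCommGroup (E q)] [∀ q, Module ℝ (E q)]
    [∀ q, TopologicalSpace (E q)] [TopologicalSpace (TotalSpace F E)] [FiberBundle F E]
    [VectorBundle ℝ F E] (IM : ModelWithCorners ℝ EM HM) (M : Type*)
    [TopologicalSpace M] [ChartedSpace HM M] : Type _ :=
  Cₛ^∞⟮I; F, E⟯ × (∀ p : M, TangentSpace IM p)

/-- `(σ, X)` is a smooth projectable section of `T^E M` over `V ⊆ M`. -/
def IsProjectableOn (Z : PreSection I F E IM M) (V : Set M) : Prop :=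
  ContMDiffOn IM IM.tangent ∞ (fun p => (⟨p, Z.2 p⟩ : TangentBundle IM M)) V ∧
    ∀ p ∈ V, L.anchor (pr p) (Z.1 (pr p)) = mfderiv IM I pr p (Z.2 p)

open Classical in
/-- The value at `p` of the projectable section `(σ, X)` (and `0` where the pair does not define an
element of the prolongation). -/
def PreSection.eval (Z : PreSection I F E IM M) (p : M) : ProlongFiber L IM pr p :=
  if h : (Z.1 (pr p), Z.2 p) ∈ ProlongFiber L IM pr p then ⟨_, h⟩ else 0

/-- The bracket `([σ, σ'], [X, X'])` of projectable sections. -/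
def PreSection.bracket (Z Z' : PreSection I F E IM M) : PreSection I F E IM M :=
  (L.bracket Z.1 Z'.1, VectorField.mlieBracket IM Z.2 Z'.2)

/-- `l`-sections of the exterior algebra of the dual of `T^E M` (not necessarily smooth). -/
abbrev ProlongForm (l : ℕ) : Type _ := ∀ p : M, ProlongFiber L IM pr p [⋀^Fin l]→L[ℝ] ℝ

variable {IM pr} in
/-- Smoothness, tested on smooth projectable sections (they span every fibre). -/
def ProlongForm.Smooth {l : ℕ} (μ : ProlongForm L IM pr l) : Prop :=
  ∀ (V : Set M) (Z : Fin l → PreSection I F E IM M), IsOpen V →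
    (∀ i, IsProjectableOn L IM pr (Z i) V) →
    ContMDiffOn IM 𝓘(ℝ, ℝ) ∞ (fun p => μ p fun i => (Z i).eval L IM pr p) V

variable {IM pr} in
/-- `η = dμ`: the Koszul formula holds at every point for all smooth projectable sections defined
near that point. As these span every fibre, `η` is unique. -/
def ProlongForm.IsExtDeriv {l : ℕ} (μ : ProlongForm L IM pr l) (η : ProlongForm L IM pr (l + 1)) :
    Prop :=
  ∀ (p : M) (V : Set M) (Z : Fin (l + 1) → PreSection I F E IM M), IsOpen V → p ∈ V →
    (∀ i, IsProjectableOn L IM pr (Z i) V) →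
    (η p fun i => (Z i).eval L IM pr p) =
      koszul (fun Z f p => dirDeriv f p (Z.2 p)) (PreSection.bracket L IM)
        (fun Z p => μ p fun i => (Z i).eval L IM pr p) Z p

variable {IM pr} in
open Classical in
/-- The exterior differential of the Lie algebroid `T^E M`. -/
def ProlongForm.d {l : ℕ} (μ : ProlongForm L IM pr l) : ProlongForm L IM pr (l + 1) :=
  if h : ∃ η, μ.IsExtDeriv L η then h.choose else 0

/-- Morphisms of Lie algebroids from `Tℝᵏ → ℝᵏ` to `T^E M → M`: smooth vector bundle maps
(`base`, `map`) such that the pull-back of forms commutes with the differentials, in every degree.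
The fibres of `Tℝᵏ` are identified with `ℝᵏ`; its algebroid differential is the de Rham
differential. -/
structure ProlongMorphism (k : ℕ) where
  base : (Fin k → ℝ) → M
  base_smooth : ContMDiff 𝓘(ℝ, Fin k → ℝ) IM ∞ base
  map : ∀ t, (Fin k → ℝ) →L[ℝ] ProlongFiber L IM pr (base t)
  map_smooth_fst : ∀ v, ContMDiff 𝓘(ℝ, Fin k → ℝ) (I.prod 𝓘(ℝ, F)) ∞
    (fun t => TotalSpace.mk' F (pr (base t)) (map t v).1.1)
  map_smooth_snd : ∀ v, ContMDiff 𝓘(ℝ, Fin k → ℝ) IM.tangent ∞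
    (fun t => (⟨base t, (map t v).1.2⟩ : TangentBundle IM M))
  pullback_d : ∀ (l : ℕ) (μ : ProlongForm L IM pr l), μ.Smooth L →
    extDeriv (fun t => (μ (base t)).compContinuousLinearMap (map t)) =
      fun t => (μ.d L (base t)).compContinuousLinearMap (map t)

/-- The fibre at `p` of the `k`-prolongation: tuples `(a₁, …, a_k, v₁, …, v_k)` with
`ρ(a_A) = T pr (v_A)` for all `A`, written as `A ↦ (a_A, v_A)`. -/
abbrev KProlongFiber (k : ℕ) (p : M) : Type _ := Fin k → ProlongFiber L IM pr p

/-- `l`-sections of the exterior algebra of the dual of the `k`-prolongation. -/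
abbrev KProlongForm (k l : ℕ) : Type _ :=
  ∀ p : M, KProlongFiber L IM pr k p [⋀^Fin l]→L[ℝ] ℝ

variable {IM pr} in
/-- `η = d^A μ`: the Koszul formula, with the anchor given by the `A`-th vector field and the bracket
taken componentwise, holds for all smooth projectable sections of the `k`-prolongation. -/
def KProlongForm.IsExtDeriv {k l : ℕ} (A : Fin k) (μ : KProlongForm L IM pr k l)
    (η : KProlongForm L IM pr k (l + 1)) : Prop :=
  ∀ (p : M) (V : Set M) (Z : Fin (l + 1) → Fin k → PreSection I F E IM M), IsOpen V → p ∈ V →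
    (∀ i B, IsProjectableOn L IM pr (Z i B) V) →
    (η p fun i B => (Z i B).eval L IM pr p) =
      koszul (fun Z f p => dirDeriv f p ((Z A).2 p))
        (fun Z Z' B => PreSection.bracket L IM (Z B) (Z' B))
        (fun Z p => μ p fun i B => (Z i B).eval L IM pr p) Z p

variable {IM pr} in
open Classical in
/-- The operator `d^A`, on those `l`-sections for which the Koszul expression is tensorial. -/
def KProlongForm.d {k l : ℕ} (A : Fin k) (μ : KProlongForm L IM pr k l) :
    KProlongForm L IM pr k (l + 1) :=
  if h : ∃ η, μ.IsExtDeriv L A η then h.choose else 0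

/-- `d^A f (z) = v_A f` for a function `f`. -/
def dFun {k : ℕ} (A : Fin k) (f : M → ℝ) (p : M) (z : KProlongFiber L IM pr k p) : ℝ :=
  dirDeriv f p (z A).1.2

/-- A smooth section of the `k`-prolongation. -/
structure KProlongSection (k : ℕ) where
  val : ∀ p : M, KProlongFiber L IM pr k p
  smooth_fst : ∀ A, ContMDiff IM (I.prod 𝓘(ℝ, F)) ∞
    (fun p => TotalSpace.mk' F (pr p) (val p A).1.1)
  smooth_snd : ∀ A, ContMDiff IM IM.tangent ∞
    (fun p => (⟨p, (val p A).1.2⟩ : TangentBundle IM M))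

variable {L IM pr} in
/-- `φ` is an integral section of the `k`-vector field of `ξ`: it is smooth and
`T φ (∂/∂t^A) = ξ_A ∘ φ`, where `ξ_A` is the `A`-th vector field. -/
def IsIntegralSection {k : ℕ} (ξ : KProlongSection L IM pr k) (φ : (Fin k → ℝ) → M) : Prop :=
  ContMDiff 𝓘(ℝ, Fin k → ℝ) IM ∞ φ ∧
    ∀ t A, mfderiv 𝓘(ℝ, Fin k → ℝ) IM φ t (Pi.single A 1 : Fin k → ℝ) = (ξ.val (φ t) A).1.2

end Prolongation

/-! ## The Hamiltonian formalism on `ℝᵏ × ⊕ᵏ E*` -/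

section Hamiltonian

variable {HB : Type*} [TopologicalSpace HB] {EB : Type*} [NormedAddCommGroup EB] [NormedSpace ℝ EB]
  {I : ModelWithCorners ℝ EB HB} {Q : Type*} [TopologicalSpace Q] [ChartedSpace HB Q]
  {F : Type*} [NormedAddCommGroup F] [NormedSpace ℝ F]
  {E : Q → Type*} [∀ q, AddCommGroup (E q)] [∀ q, Module ℝ (E q)] [∀ q, TopologicalSpace (E q)]
  [∀ q, IsTopologicalAddGroup (E q)] [∀ q, ContinuousSMul ℝ (E q)]
  [TopologicalSpace (TotalSpace F E)] [FiberBundle F E] [VectorBundle ℝ F E]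
  [IsManifold I ∞ Q] [ContMDiffVectorBundle ∞ F E I]
  (L : LieAlgebroid I F E) (k : ℕ)

/-- The total space of `⊕ᵏ E*`. A `k`-tuple `(b₁, …, b_k)` of covectors on `E_q` is recorded as the
linear map `a ↦ (b₁(a), …, b_k(a))` from `E_q` to `ℝᵏ`. -/
abbrev MomentumSpace (F : Type*) [NormedAddCommGroup F] [NormedSpace ℝ F] (E : Q → Type*)
    [∀ q, AddCommGroup (E q)] [∀ q, Module ℝ (E q)] [∀ q, TopologicalSpace (E q)] : Type _ :=
  TotalSpace (F →L[ℝ] (Fin k → ℝ)) (fun q => E q →L[ℝ] Bundle.Trivial Q (Fin k → ℝ) q)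

/-- The phase space `ℝᵏ × ⊕ᵏ E*`. -/
abbrev PhaseSpace (F : Type*) [NormedAddCommGroup F] [NormedSpace ℝ F] (E : Q → Type*)
    [∀ q, AddCommGroup (E q)] [∀ q, Module ℝ (E q)] [∀ q, TopologicalSpace (E q)] : Type _ :=
  (Fin k → ℝ) × MomentumSpace k F E

/-- The model with corners of the phase space. -/
abbrev phaseModel (I : ModelWithCorners ℝ EB HB) (F : Type*) [NormedAddCommGroup F]
    [NormedSpace ℝ F] :=
  (𝓘(ℝ, Fin k → ℝ)).prod (I.prod 𝓘(ℝ, F →L[ℝ] (Fin k → ℝ)))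

/-- The projection `ℝᵏ × ⊕ᵏ E* → Q`. -/
abbrev phaseProj (F : Type*) [NormedAddCommGroup F] [NormedSpace ℝ F] (E : Q → Type*)
    [∀ q, AddCommGroup (E q)] [∀ q, Module ℝ (E q)] [∀ q, TopologicalSpace (E q)] :
    PhaseSpace k F E → Q := fun p => p.2.proj

variable {k} in
/-- The value `b_A(a)` of the `A`-th covector of a point `(t, b₁, …, b_k)` of the phase space. -/
def covector (p : PhaseSpace k F E) (A : Fin k) : E (phaseProj k F E p) →L[ℝ] ℝ :=
  (ContinuousLinearMap.proj A : (Fin k → ℝ) →L[ℝ] ℝ).comp p.2.2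

/-- Fibres of the `k`-prolongation `T^E_k(⊕ᵏ E*)`. -/
abbrev HFiber (p : PhaseSpace k F E) : Type _ :=
  KProlongFiber L (phaseModel k I F) (phaseProj k F E) k p

variable {k} in
/-- The Liouville `1`-section `Θ^A (a, v) = b_A (a_A)` at `(t, b)`. -/
def liouville (A : Fin k) : KProlongForm L (phaseModel k I F) (phaseProj k F E) k 1 := fun p =>
  ContinuousAlternatingMap.ofSubsingleton ℝ _ ℝ (0 : Fin 1)
    ((covector p A).comp ((ContinuousLinearMap.fst ℝ _ _).comp
      ((ProlongFiber L (phaseModel k I F) (phaseProj k F E) p).subtypeL.comp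
        (ContinuousLinearMap.proj A))))

variable {k} in
/-- The Liouville `2`-section `Ω^A = -d^A Θ^A`. -/
def liouvilleOmega (A : Fin k) : KProlongForm L (phaseModel k I F) (phaseProj k F E) k 2 := fun p =>
  -(liouville L A).d L A p

variable {k} in
/-- `Y_A^C (z)`, the `∂/∂t^C` component of the `A`-th tangent vector of `z`. -/
def timeComponent (A C : Fin k) (p : PhaseSpace k F E) (z : HFiber L k p) : ℝ :=
  dirDeriv (I := phaseModel k I F) (fun p' : PhaseSpace k F E => p'.1 C) p (z A).1.2

variable {k} in
/-- `∂H/∂t^B`. -/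
def timePartial (H : PhaseSpace k F E → ℝ) (B : Fin k) (p : PhaseSpace k F E) : ℝ :=
  fderiv ℝ (fun t => H (t, p.2)) p.1 (Pi.single B 1)

variable {k} in
/-- The `1`-section `d^A H - ∑_B (∂H/∂t^B) Y_A^B` of the dual of the `k`-prolongation. -/
def hamiltonRHS (H : PhaseSpace k F E → ℝ) (A : Fin k) (p : PhaseSpace k F E)
    (z : HFiber L k p) : ℝ :=
  dFun L (phaseModel k I F) (phaseProj k F E) A H p z -
    ∑ B, timePartial H B p * timeComponent L A B p z

variable {k L} in
/-- The Hamiltonian equations `Y_A^C(ξ) = δ_A^C` and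
`i_ξ Ω^A = (1/k) (d^A H - ∑_B (∂H/∂t^B) Y_A^B)` for every `A`. -/
def HamiltonEquations (H : PhaseSpace k F E → ℝ)
    (ξ : KProlongSection L (phaseModel k I F) (phaseProj k F E) k) : Prop :=
  (∀ A C p, timeComponent L A C p (ξ.val p) = if A = C then 1 else 0) ∧
    ∀ A p (z : HFiber L k p),
      liouvilleOmega L A p ![ξ.val p, z] = 1 / (k : ℝ) * hamiltonRHS L H A p z

variable {k L} in
/-- The sum over `A` of the equations `i_ξ Ω^A = (1/k) (d^A H - ∑_B (∂H/∂t^B) Y_A^B)`, required only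
on the diagonal elements `(z, …, z)`. -/
def SummedHamiltonEquations (H : PhaseSpace k F E → ℝ)
    (ξ : KProlongSection L (phaseModel k I F) (phaseProj k F E) k) : Prop :=
  (∀ A C p, timeComponent L A C p (ξ.val p) = if A = C then 1 else 0) ∧
    ∀ p (z : ProlongFiber L (phaseModel k I F) (phaseProj k F E) p),
      ∑ A, liouvilleOmega L A p ![ξ.val p, fun _ => z] =
        ∑ A, 1 / (k : ℝ) * hamiltonRHS L H A p (fun _ => z)

end Hamiltonian

/-! ## Local coordinates -/

section Fibre

variable {Q : Type*} [TopologicalSpace Q] {F : Type*} [NormedAddCommGroup F] [NormedSpace ℝ F]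
  {E : Q → Type*} [∀ q, AddCommGroup (E q)] [∀ q, Module ℝ (E q)] [∀ q, TopologicalSpace (E q)]
  [TopologicalSpace (TotalSpace F E)] [FiberBundle F E] [VectorBundle ℝ F E]

variable (F) in
/-- The fibre `E q` is isomorphic to the model fibre. -/
def fibreEquiv (q : Q) : E q ≃L[ℝ] F :=
  (trivializationAt F E q).continuousLinearEquivAt ℝ q (mem_baseSet_trivializationAt F E q)

variable (F) in
/-- A linear map from a fibre of a bundle of finite rank to `ℝᵏ`, as a continuous linear map. -/
def fibreCLM [FiniteDimensional ℝ F] {k : ℕ} (q : Q) (b : E q →ₗ[ℝ] (Fin k → ℝ)) :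
    E q →L[ℝ] (Fin k → ℝ) :=
  (LinearMap.toContinuousLinearMap
    (b ∘ₗ (fibreEquiv (E := E) F q).symm.toLinearEquiv.toLinearMap)).comp
    (fibreEquiv (E := E) F q).toContinuousLinearMap

theorem fibreCLM_apply [FiniteDimensional ℝ F] {k : ℕ} (q : Q) (b : E q →ₗ[ℝ] (Fin k → ℝ))
    (a : E q) : fibreCLM F q b a = b a := by
  simp [fibreCLM]

end Fibre

section Coordinates

variable {n : ℕ} {Q : Type*} [TopologicalSpace Q] [ChartedSpace (EuclideanSpace ℝ (Fin n)) Q]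
  {F : Type*} [NormedAddCommGroup F] [NormedSpace ℝ F] [FiniteDimensional ℝ F]
  {E : Q → Type*} [∀ q, AddCommGroup (E q)] [∀ q, Module ℝ (E q)] [∀ q, TopologicalSpace (E q)]
  [∀ q, IsTopologicalAddGroup (E q)] [∀ q, ContinuousSMul ℝ (E q)]
  [TopologicalSpace (TotalSpace F E)] [FiberBundle F E] [VectorBundle ℝ F E]
  [IsManifold (𝓡 n) ∞ Q] [ContMDiffVectorBundle ∞ F E (𝓡 n)]
  (L : LieAlgebroid (𝓡 n) F E) {k m : ℕ}
  (φ : OpenPartialHomeomorph Q (EuclideanSpace ℝ (Fin n)))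
  {e : Fin m → ∀ q, E q}

/-- `ρ^i_α`, from `ρ(e_α) = ρ^i_α ∂/∂q^i`. -/
def anchorCoeff (e : Fin m → ∀ q, E q) (i : Fin n) (α : Fin m) (q : Q) : ℝ :=
  dirDeriv (I := 𝓡 n) (fun q' => φ q' i) q (L.anchor q (e α q))

/-- `C α β γ = C^γ_{αβ}` are the structure functions over `U` of the local basis `e` of sections:
`[e_α, e_β] = C^γ_{αβ} e_γ`. The bracket of local sections at `q` is computed from global sections
with the same germs at `q`. -/
def IsStructureFunctions (e : Fin m → ∀ q, E q) (U : Set Q)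
    (C : Fin m → Fin m → Fin m → Q → ℝ) : Prop :=
  ∀ q ∈ U, ∀ α β (S T : Cₛ^∞⟮𝓡 n; F, E⟯), (∀ᶠ q' in 𝓝 q, S q' = e α q') →
    (∀ᶠ q' in 𝓝 q, T q' = e β q') → L.bracket S T q = ∑ γ, C α β γ q • e γ q

variable {L φ} in
/-- The point of the phase space with local coordinates `(t^A, q^i, y_α^A)`, that is, the time `t`,
the point `q = φ⁻¹(x)` and the covectors `b_A = ∑_α y_α^A e^α(q)`, where `e^α` is the dual basis. -/
def coordPoint (he : IsLocalFrameOn (𝓡 n) F ∞ e φ.source) (t : Fin k → ℝ)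
    (x : EuclideanSpace ℝ (Fin n)) (y : Fin k → Fin m → ℝ) : PhaseSpace k F E :=
  (t, ⟨φ.symm x, fibreCLM F (φ.symm x)
    (LinearMap.pi fun A => ∑ α, y A α • he.coeff α (φ.symm x))⟩)

/-- The coordinate functions `y_α^A (t, b) = b_A(e_α)` on the phase space. -/
def momentumCoord (e : Fin m → ∀ q, E q) (A : Fin k) (α : Fin m) (p : PhaseSpace k F E) : ℝ :=
  covector p A (e α (phaseProj k F E p))

variable {φ} in
/-- `∂H/∂q^i` at `p`, in the coordinates `(t^A, q^i, y_α^A)`. -/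
def basePartial (he : IsLocalFrameOn (𝓡 n) F ∞ e φ.source) (H : PhaseSpace k F E → ℝ) (i : Fin n)
    (p : PhaseSpace k F E) : ℝ :=
  fderiv ℝ (fun x => H (coordPoint he p.1 x fun A α => momentumCoord e A α p))
    (φ (phaseProj k F E p)) (EuclideanSpace.single i 1)

variable {φ} in
/-- `∂H/∂y_α^A` at `p`, in the coordinates `(t^A, q^i, y_α^A)`. -/
def momentumPartial (he : IsLocalFrameOn (𝓡 n) F ∞ e φ.source) (H : PhaseSpace k F E → ℝ)
    (A : Fin k) (α : Fin m) (p : PhaseSpace k F E) : ℝ :=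
  fderiv ℝ (fun y => H (coordPoint he p.1 (φ (phaseProj k F E p)) y))
    (fun A α => momentumCoord e A α p) (Pi.single A (Pi.single α 1))

/-- `∂f/∂t^A` for a function `f` on `ℝᵏ`. -/
def partialT (A : Fin k) (f : (Fin k → ℝ) → ℝ) (t : Fin k → ℝ) : ℝ :=
  fderiv ℝ f t (Pi.single A 1)

/-! Local components of a morphism `ψ` from `Tℝᵏ` to the prolongation over the phase space. -/

section Components

variable {L} (ψ : ProlongMorphism L (phaseModel k (𝓡 n) F) (phaseProj k F E) k)

/-- `ψ^i = q^i ∘ ψ`. -/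
def psiBase (i : Fin n) (t : Fin k → ℝ) : ℝ := φ (phaseProj k F E (ψ.base t)) i

/-- `ψ^A_α = y_α^A ∘ ψ`. -/
def psiMomentum (e : Fin m → ∀ q, E q) (A : Fin k) (α : Fin m) (t : Fin k → ℝ) : ℝ :=
  momentumCoord e A α (ψ.base t)

variable {φ} in
/-- `ψ^α_A`: the coefficient of `ψ(∂/∂t^A)` along `X_α = (e_α, ρ^i_α ∂/∂q^i)`. -/
def psiFibre (he : IsLocalFrameOn (𝓡 n) F ∞ e φ.source) (α : Fin m) (A : Fin k)
    (t : Fin k → ℝ) : ℝ :=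
  he.coeff α (phaseProj k F E (ψ.base t)) (ψ.map t (Pi.single A 1)).1.1

/-- `ψ^B_{βA}`: the coefficient of `ψ(∂/∂t^A)` along `V^β_B = (0, ∂/∂y_β^B)`. -/
def psiVertical (e : Fin m → ∀ q, E q) (B : Fin k) (β : Fin m) (A : Fin k)
    (t : Fin k → ℝ) : ℝ :=
  dirDeriv (I := phaseModel k (𝓡 n) F) (momentumCoord e B β) (ψ.base t)
    (ψ.map t (Pi.single A 1)).1.2

end Components

end Coordinates

end

set_option linter.unusedSectionVars false

noncomputable section

/-! ## Derivatives of functions along tangent vectors -/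

section DirDeriv

variable {HB : Type*} [TopologicalSpace HB] {EB : Type*} [NormedAddCommGroup EB] [NormedSpace ℝ EB]
  {I : ModelWithCorners ℝ EB HB} {Q : Type*} [TopologicalSpace Q] [ChartedSpace HB Q]
  {HM : Type*} [TopologicalSpace HM] {EM : Type*} [NormedAddCommGroup EM] [NormedSpace ℝ EM]
  {IM : ModelWithCorners ℝ EM HM} {M : Type*} [TopologicalSpace M] [ChartedSpace HM M]

/-! The two Hamilton equations come from `ξ` and the base map of `ψ`; the other three express that
`ψ` is a morphism into the prolongation.

Write $a^\alpha_A$ for the coefficients of $a_A$ in the frame $e_\alpha$. The Koszul formula gives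
$\Omega^A(z,z')=a^\alpha_A\,v'_A(y^A_\alpha)-a'^\alpha_A\,v_A(y^A_\alpha)+a^\alpha_A
a'^\beta_A\,\mathcal C^\gamma_{\alpha\beta}\,y^A_\gamma$ (`liouvilleOmega_apply`). Only the equation
summed over $A$ on diagonal elements is needed. On such elements without time components the right
side is $v(H)$, because $k$ equal terms carry the factor $1/k$. Testing with $\mathcal V^\beta_B$
isolates one coefficient of `ξ`, which is $\partial H/\partial y^B_\beta$
(`SummedHamiltonEquations.coeff_eq`). Testing with $\mathcal X_\beta$ gives $\sum_A v_A(y^A_\beta)$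
for `ξ` (`SummedHamiltonEquations.sum_dirDeriv_momentumCoord`). Along an integral section the $v_A$
are the velocities, and $\rho(a_A)=T\pi(v_A)$ converts the coefficients into
$\partial\psi^i/\partial t^A$.

For the morphism, compatibility with $d$ on functions forces the tangent part of $\overline\psi$ to
be $T\underline\psi$ (`ProlongMorphism.map_snd_eq_mfderiv`). Compatibility on the dual coframe
$e^\alpha$ is the Maurer–Cartan equation (`ProlongMorphism.fderiv_coeff_sub_fderiv_coeff`).

The remaining work makes the differentials computable, since they are characterised only by the
Koszul formula on projectable sections. This needs three facts. The bracket of projectable sections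
stays in the prolongation (`IsProjectableOn.coe_eval_bracket`); this rests on the anchor preserving
brackets, a consequence of Jacobi and Leibniz. The Koszul expression of a $1$-section
$(a,v)\mapsto\ell_p(a)$ is tensorial (`SmoothFunctional.koszul_eq`). Every element of the
prolongation is the value of a projectable section (`exists_isProjectableOn`). As the bracket of $E$
acts on global sections, local frames are replaced throughout by global sections with the same
germs. -/

theorem dirDeriv_smul_vec (f : Q → ℝ) (q : Q) (c : ℝ) (v : TangentSpace I q) :
    dirDeriv f q (c • v) = c * dirDeriv f q v :=
  map_smul (mfderiv I 𝓘(ℝ, ℝ) f q) c v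

theorem dirDeriv_zero_vec (f : Q → ℝ) (q : Q) : dirDeriv f q (0 : TangentSpace I q) = 0 :=
  map_zero (mfderiv I 𝓘(ℝ, ℝ) f q)

theorem dirDeriv_sum_vec {ι : Type*} (s : Finset ι) (f : Q → ℝ) (q : Q)
    (v : ι → TangentSpace I q) :
    dirDeriv f q (∑ i ∈ s, v i) = ∑ i ∈ s, dirDeriv f q (v i) :=
  map_sum (mfderiv I 𝓘(ℝ, ℝ) f q) v s

theorem dirDeriv_congr {f g : Q → ℝ} {q : Q} (h : f =ᶠ[𝓝 q] g) (v : TangentSpace I q) :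
    dirDeriv f q v = dirDeriv g q v := by
  unfold dirDeriv; rw [h.mfderiv_eq]; rfl

theorem dirDeriv_const (c : ℝ) (q : Q) (v : TangentSpace I q) :
    dirDeriv (fun _ => c) q v = 0 := by
  unfold dirDeriv; rw [mfderiv_const]; rfl

theorem dirDeriv_add {f g : Q → ℝ} {q : Q} (hf : MDifferentiableAt I 𝓘(ℝ, ℝ) f q)
    (hg : MDifferentiableAt I 𝓘(ℝ, ℝ) g q) (v : TangentSpace I q) :
    dirDeriv (fun x => f x + g x) q v = dirDeriv f q v + dirDeriv g q v := by
  have := (hf.hasMFDerivAt.add hg.hasMFDerivAt).mfderiv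
  exact congrArg (fun l => (l : TangentSpace I q →L[ℝ] ℝ) v) this

theorem dirDeriv_mul {f g : Q → ℝ} {q : Q} (hf : MDifferentiableAt I 𝓘(ℝ, ℝ) f q)
    (hg : MDifferentiableAt I 𝓘(ℝ, ℝ) g q) (v : TangentSpace I q) :
    dirDeriv (fun x => f x * g x) q v = f q * dirDeriv g q v + g q * dirDeriv f q v := by
  have := (hf.hasMFDerivAt.mul hg.hasMFDerivAt).mfderiv
  exact congrArg (fun l => (l : TangentSpace I q →L[ℝ] ℝ) v) this

theorem dirDeriv_sum {ι : Type} (s : Finset ι) {f : ι → Q → ℝ} {q : Q}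
    (hf : ∀ i ∈ s, MDifferentiableAt I 𝓘(ℝ, ℝ) (f i) q) (v : TangentSpace I q) :
    dirDeriv (fun x => ∑ i ∈ s, f i x) q v = ∑ i ∈ s, dirDeriv (f i) q v := by
  classical
  induction s using Finset.induction_on with
  | empty => simpa using dirDeriv_const 0 q v
  | insert a s ha ih =>
    simp only [Finset.sum_insert ha]
    rw [dirDeriv_add (hf a (by simp)), ih fun i hi => hf i (by simp [hi])]
    rw [show (fun x => ∑ i ∈ s, f i x) = ∑ i ∈ s, f i from (Finset.sum_fn s f).symm]
    exact MDifferentiableAt.sum (t := s) (f := f) fun i hi => hf i (Finset.mem_insert_of_mem hi)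

theorem dirDeriv_comp {f : Q → ℝ} {g : M → Q} {p : M}
    (hf : MDifferentiableAt I 𝓘(ℝ, ℝ) f (g p)) (hg : MDifferentiableAt IM I g p)
    (v : TangentSpace IM p) :
    dirDeriv (fun x => f (g x)) p v = dirDeriv f (g p) (mfderiv IM I g p v) := by
  have := (hf.hasMFDerivAt.comp p hg.hasMFDerivAt).mfderiv
  exact congrArg (fun l => (l : TangentSpace IM p →L[ℝ] ℝ) v) this

theorem dirDeriv_eq_fderiv {f : EB → ℝ} {x : EB} (v : EB) :
    dirDeriv (I := 𝓘(ℝ, EB)) f x v = fderiv ℝ f x v := by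
  unfold dirDeriv; rw [mfderiv_eq_fderiv]; rfl

theorem ContMDiffOn.dirDeriv [IsManifold IM ∞ M] {f : M → ℝ} {V : Set M} (hV : IsOpen V)
    (hf : ContMDiffOn IM 𝓘(ℝ, ℝ) ∞ f V) {X : ∀ p : M, TangentSpace IM p}
    (hX : ContMDiffOn IM IM.tangent ∞ (fun p => (⟨p, X p⟩ : TangentBundle IM M)) V) :
    ContMDiffOn IM 𝓘(ℝ, ℝ) ∞ (fun p => dirDeriv f p (X p)) V := by
  have : IsManifold IM 1 M := IsManifold.of_le (n := ∞) (by simp)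
  have h1 := hf.contMDiffOn_tangentMapWithin (m := ∞) (by simp) hV.uniqueMDiffOn
  have h2 := h1.comp hX (fun p hp => hp)
  have h3 := (contMDiff_snd_tangentBundle_modelSpace (n := ∞) ℝ 𝓘(ℝ, ℝ)).comp_contMDiffOn h2
  refine h3.congr fun p hp => ?_
  simp only [Function.comp, tangentMapWithin, _root_.dirDeriv]
  rw [mfderivWithin_of_isOpen hV hp]

theorem two_le_infty : (2 : WithTop ℕ∞) ≤ ∞ := by
  exact WithTop.coe_le_coe.2 (le_top : (2 : ℕ∞) ≤ ⊤)

theorem dirDeriv_inverse_extChartAt [IsManifold IM 1 M] {f : M → ℝ} {p : M}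
    (hf : DifferentiableAt ℝ (f ∘ (extChartAt IM p).symm) (extChartAt IM p p)) (l : EM) :
    dirDeriv f p ((mfderiv IM 𝓘(ℝ, EM) (extChartAt IM p) p).inverse l) =
      fderiv ℝ (f ∘ (extChartAt IM p).symm) (extChartAt IM p p) l := by
  have h1 : f =ᶠ[𝓝 p] fun x => (f ∘ (extChartAt IM p).symm) (extChartAt IM p x) := by
    filter_upwards [extChartAt_source_mem_nhds (I := IM) p] with x hx
    exact congrArg f ((extChartAt IM p).left_inv hx).symm
  rw [dirDeriv_congr h1, dirDeriv_comp hf.mdifferentiableAt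
    (mdifferentiableAt_extChartAt (mem_chart_source HM p))]
  refine (dirDeriv_eq_fderiv _).trans ?_
  obtain ⟨e, he⟩ := isInvertible_mfderiv_extChartAt (I := IM) (mem_extChartAt_source (I := IM) p)
  rw [← he, ContinuousLinearMap.inverse_equiv]
  exact congrArg _ (e.apply_symm_apply l)

/-- The manifold bracket is the chart transport of the bracket in the model space, where the
identity is the symmetry of second derivatives. -/
theorem dirDeriv_mlieBracket [IsManifold IM ∞ M] [IM.Boundaryless] [CompleteSpace EM] {f : M → ℝ}
    {V : Set M} (hV : IsOpen V) (hf : ContMDiffOn IM 𝓘(ℝ, ℝ) ∞ f V)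
    {X Y : ∀ p : M, TangentSpace IM p}
    (hX : ContMDiffOn IM IM.tangent ∞ (fun p => (⟨p, X p⟩ : TangentBundle IM M)) V)
    (hY : ContMDiffOn IM IM.tangent ∞ (fun p => (⟨p, Y p⟩ : TangentBundle IM M)) V)
    {p : M} (hp : p ∈ V) :
    dirDeriv f p (VectorField.mlieBracket IM X Y p) =
      dirDeriv (fun p' => dirDeriv f p' (Y p')) p (X p) -
        dirDeriv (fun p' => dirDeriv f p' (X p')) p (Y p) := by
  have : IsManifold IM 1 M := IsManifold.of_le (n := ∞) (by simp)
  have : IsManifold IM 2 M := IsManifold.of_le (n := ∞) two_le_infty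
  set φ := extChartAt IM p with hφ
  -- `pb Z` is the expression of the field `Z` in the chart at `p`.
  let pb : (∀ p : M, TangentSpace IM p) → EM → EM := fun Z =>
    VectorField.mpullbackWithin 𝓘(ℝ, EM) IM φ.symm Z (range IM)
  have hsymm : ∀ x ∈ φ.target, MDifferentiableAt 𝓘(ℝ, EM) IM φ.symm x := fun x hx =>
    ((contMDiffOn_extChartAt_symm (I := IM) (n := ∞) p).contMDiffAt
      ((isOpen_extChartAt_target p).mem_nhds hx)).mdifferentiableAt (by simp)
  have hinv : ∀ x ∈ φ.target, (mfderiv 𝓘(ℝ, EM) IM φ.symm x).IsInvertible := fun x hx => by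
    have := isInvertible_mfderivWithin_extChartAt_symm (I := IM) hx
    rwa [IM.range_eq_univ, mfderivWithin_univ] at this
  have hpb : ∀ (Z : ∀ p : M, TangentSpace IM p), ∀ x ∈ φ.target,
      mfderiv 𝓘(ℝ, EM) IM φ.symm x (pb Z x) = Z (φ.symm x) := fun Z x hx => by
    simp only [pb, VectorField.mpullbackWithin_apply, IM.range_eq_univ, mfderivWithin_univ]
    obtain ⟨e, he⟩ := hinv x hx
    rw [← he, ContinuousLinearMap.inverse_equiv]
    exact e.apply_symm_apply _
  have hW : IsOpen (φ.target ∩ φ.symm ⁻¹' V) :=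
    (continuousOn_extChartAt_symm (I := IM) p).isOpen_inter_preimage
      (isOpen_extChartAt_target p) hV
  have hpW : φ p ∈ φ.target ∩ φ.symm ⁻¹' V :=
    ⟨mem_extChartAt_target p, by simpa [hφ, extChartAt_to_inv] using hp⟩
  -- Differentiation along a field commutes with passing to the chart. It is used for `f` itself and
  -- again for its first derivatives along `X` and `Y`.
  have key : ∀ (g : M → ℝ) (Z : ∀ p : M, TangentSpace IM p), ContMDiffOn IM 𝓘(ℝ, ℝ) ∞ g V →
      ∀ x ∈ φ.target ∩ φ.symm ⁻¹' V,
      fderiv ℝ (g ∘ φ.symm) x (pb Z x) = dirDeriv g (φ.symm x) (Z (φ.symm x)) := by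
    intro g Z hg x hx
    rw [← dirDeriv_eq_fderiv, ← hpb Z x hx.1]
    exact dirDeriv_comp ((hg.contMDiffAt (hV.mem_nhds hx.2)).mdifferentiableAt (by simp))
      (hsymm x hx.1) _
  have hsm : ContDiffAt ℝ ∞ (f ∘ φ.symm) (φ p) := by
    rw [← contMDiffAt_iff_contDiffAt]
    refine ContMDiffAt.comp (I' := IM) _ (hf.contMDiffAt (hV.mem_nhds hpW.2)) ?_
    exact (contMDiffOn_extChartAt_symm (I := IM) (n := ∞) p).contMDiffAt
      ((isOpen_extChartAt_target p).mem_nhds hpW.1)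
  have hdiff : ∀ Z : ∀ p : M, TangentSpace IM p,
      ContMDiffOn IM IM.tangent ∞ (fun p => (⟨p, Z p⟩ : TangentBundle IM M)) V →
      DifferentiableAt ℝ (pb Z) (φ p) := by
    intro Z hZ
    have h := ((hZ.contMDiffAt (hV.mem_nhds hp)).mdifferentiableAt
      (by simp)).mdifferentiableWithinAt (s := univ)
    have := MDifferentiableWithinAt.differentiableWithinAt_mpullbackWithin_vectorField h
    rw [preimage_univ, univ_inter, IM.range_eq_univ] at this
    simp only [pb, IM.range_eq_univ]
    exact differentiableWithinAt_univ.mp this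
  have hbr := VectorField.fderiv_apply_lieBracket hsm
    (by rw [minSmoothness_of_isRCLikeNormedField]; exact two_le_infty) (hdiff Y hY) (hdiff X hX)
  have hφV : ∀ᶠ x in 𝓝 (φ p), x ∈ φ.target ∩ φ.symm ⁻¹' V := hW.mem_nhds hpW
  have h1 : (fun x => fderiv ℝ (f ∘ φ.symm) x (pb Y x)) =ᶠ[𝓝 (φ p)]
      (fun p' => dirDeriv f p' (Y p')) ∘ φ.symm := hφV.mono fun x hx => key f Y hf x hx
  have h2 : (fun x => fderiv ℝ (f ∘ φ.symm) x (pb X x)) =ᶠ[𝓝 (φ p)]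
      (fun p' => dirDeriv f p' (X p')) ∘ φ.symm := hφV.mono fun x hx => key f X hf x hx
  rw [h1.fderiv_eq, h2.fderiv_eq, key _ X (hf.dirDeriv hV hY) _ hpW,
    key _ Y (hf.dirDeriv hV hX) _ hpW] at hbr
  rw [extChartAt_to_inv] at hbr
  rw [← hbr]
  have hm : VectorField.mlieBracket IM X Y p = (mfderiv IM 𝓘(ℝ, EM) φ p).inverse
      (VectorField.lieBracket (E := EM) ℝ (pb X) (pb Y) (φ p) : EM) := by
    rw [← VectorField.lieBracketWithin_univ]
    change VectorField.mlieBracketWithin IM X Y univ p = _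
    rw [VectorField.mlieBracketWithin_apply, preimage_univ, univ_inter]
    simp only [pb, IM.range_eq_univ]
    rfl
  rw [hm, dirDeriv_inverse_extChartAt (hsm.differentiableAt (by simp)), hbr]

end DirDeriv

/-! ## Cut-off functions and extension of local objects -/

section Extension

variable {HB : Type*} [TopologicalSpace HB] {EB : Type*} [NormedAddCommGroup EB] [NormedSpace ℝ EB]
  [FiniteDimensional ℝ EB]
  {I : ModelWithCorners ℝ EB HB} {Q : Type*} [TopologicalSpace Q] [ChartedSpace HB Q] [T2Space Q]
  [IsManifold I ∞ Q]

variable (I) in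
theorem exists_contMDiff_bump {q : Q} {U : Set Q} (hU : U ∈ 𝓝 q) :
    ∃ χ : Q → ℝ, ContMDiff I 𝓘(ℝ, ℝ) ∞ χ ∧ χ =ᶠ[𝓝 q] 1 ∧ tsupport χ ⊆ U := by
  obtain ⟨χ, -, hχ⟩ := (SmoothBumpFunction.nhds_basis_tsupport (I := I) q).mem_iff.1 hU
  exact ⟨χ, χ.contMDiff, χ.eventuallyEq_one, hχ⟩

theorem exists_contMDiff_eventuallyEq {q : Q} {U : Set Q} (hU : IsOpen U) (hq : q ∈ U) {f : Q → ℝ}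
    (hf : ContMDiffOn I 𝓘(ℝ, ℝ) ∞ f U) :
    ∃ g : Q → ℝ, ContMDiff I 𝓘(ℝ, ℝ) ∞ g ∧ g =ᶠ[𝓝 q] f := by
  obtain ⟨χ, hχ, h1, hs⟩ := exists_contMDiff_bump I (hU.mem_nhds hq)
  refine ⟨fun x => χ x * f x, contMDiff_of_tsupport fun x hx => ?_, ?_⟩
  · have hx' : x ∈ U := hs (closure_mono (Function.support_mul_subset_left χ f) hx)
    exact hχ.contMDiffAt.mul (hf.contMDiffAt (hU.mem_nhds hx'))
  · filter_upwards [h1] with x hx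
    simp [hx]

/-- Tangent vectors are separated by smooth functions. -/
theorem eq_of_dirDeriv_eq {q : Q} {v w : TangentSpace I q}
    (h : ∀ f : Q → ℝ, ContMDiff I 𝓘(ℝ, ℝ) ∞ f → dirDeriv f q v = dirDeriv f q w) : v = w := by
  have : IsManifold I 1 Q := IsManifold.of_le (n := ∞) (by simp)
  obtain ⟨e, he⟩ := isInvertible_mfderiv_extChartAt (I := I) (mem_extChartAt_source (I := I) q)
  apply e.injective
  have hmd : MDifferentiableAt I 𝓘(ℝ, EB) (extChartAt I q) q :=
    mdifferentiableAt_extChartAt (mem_chart_source HB q)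
  have key : ∀ (l : EB →L[ℝ] ℝ) (u : TangentSpace I q), 
      dirDeriv (fun x => l (extChartAt I q x)) q u = l (e u) := by
    intro l u
    have := dirDeriv_comp (f := l) (g := extChartAt I q) l.differentiableAt.mdifferentiableAt hmd u
    refine this.trans ((dirDeriv_eq_fderiv _).trans ?_)
    rw [l.fderiv, ← he]
    rfl
  have : ∀ l : EB →L[ℝ] ℝ, l (e v) = l (e w) := by
    intro l
    rw [← key, ← key]
    obtain ⟨g, hg, hgl⟩ := exists_contMDiff_eventuallyEq (I := I) (f := fun x => l (extChartAt I q x))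
      (chartAt HB q).open_source (mem_chart_source HB q)
      (l.contMDiff.comp_contMDiffOn (contMDiffOn_extChartAt (n := ∞)))
    rw [← dirDeriv_congr hgl, ← dirDeriv_congr hgl, h g hg]
  obtain ⟨b⟩ : Nonempty (Module.Basis (Fin (Module.finrank ℝ EB)) ℝ EB) := ⟨Module.finBasis ℝ EB⟩
  refine b.ext_elem fun i => ?_
  exact this (LinearMap.toContinuousLinearMap (b.coord i))

variable {F : Type*} [NormedAddCommGroup F] [NormedSpace ℝ F]
  {E : Q → Type*} [∀ q, AddCommGroup (E q)] [∀ q, Module ℝ (E q)] [∀ q, TopologicalSpace (E q)]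
  [∀ q, IsTopologicalAddGroup (E q)] [∀ q, ContinuousSMul ℝ (E q)]
  [TopologicalSpace (TotalSpace F E)] [FiberBundle F E] [VectorBundle ℝ F E]
  [ContMDiffVectorBundle ∞ F E I]

theorem exists_contMDiffSection_eventuallyEq {q : Q} {U : Set Q} (hU : IsOpen U) (hq : q ∈ U)
    {s : ∀ q, E q} (hs : ContMDiffOn I (I.prod 𝓘(ℝ, F)) ∞ (fun q => TotalSpace.mk' F q (s q)) U) :
    ∃ σ : Cₛ^∞⟮I; F, E⟯, ∀ᶠ x in 𝓝 q, σ x = s x := by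
  obtain ⟨χ, hχ, h1, ht⟩ := exists_contMDiff_bump I (hU.mem_nhds hq)
  refine ⟨⟨χ • s, hχ.contMDiffOn.smul_section_of_tsupport hU ht hs⟩, ?_⟩
  filter_upwards [h1] with x hx
  change χ x • s x = s x
  simp [hx]

/-- A constant-coefficient combination of a local frame is cut off to a global section. -/
theorem exists_contMDiffSection_apply_eq [FiniteDimensional ℝ F] (q : Q) (a : E q) :
    ∃ σ : Cₛ^∞⟮I; F, E⟯, σ q = a := by
  let t := trivializationAt F E q
  have hq := mem_baseSet_trivializationAt F E q
  let b := Module.finBasis ℝ F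
  have hfr := t.isLocalFrameOn_localFrame_baseSet I ∞ b
  let c := fun i => hfr.coeff i q a
  have hs : ContMDiffOn I (I.prod 𝓘(ℝ, F)) ∞
      (fun x => TotalSpace.mk' F x (∑ i, c i • t.localFrame b i x)) t.baseSet :=
    ContMDiffOn.sum_section fun i _ => (contMDiffOn_const (c := c i)).smul_section (hfr.contMDiffOn i)
  obtain ⟨σ, hσ⟩ := exists_contMDiffSection_eventuallyEq t.open_baseSet hq hs
  refine ⟨σ, ?_⟩
  rw [hσ.self_of_nhds]
  classical
  -- The frame expansion is stated for sections; the updated zero section, not continuous in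
  -- general, merely carries the value `a` at `q`.
  simpa using (hfr.coeff_sum_eq (Function.update (fun x => (0 : E x)) q a) hq).symm

/-- The product of a smooth function and a smooth section. -/
def smulSection (f : Q → ℝ) (hf : ContMDiff I 𝓘(ℝ, ℝ) ∞ f) (σ : Cₛ^∞⟮I; F, E⟯) : Cₛ^∞⟮I; F, E⟯ :=
  ⟨fun q => f q • σ q, hf.smul_section σ.contMDiff⟩

end Extension

/-! ## Local computations in a Lie algebroid -/

namespace LieAlgebroid

variable {HB : Type*} [TopologicalSpace HB] {EB : Type*} [NormedAddCommGroup EB] [NormedSpace ℝ EB]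
  [FiniteDimensional ℝ EB]
  {I : ModelWithCorners ℝ EB HB} {Q : Type*} [TopologicalSpace Q] [ChartedSpace HB Q] [T2Space Q]
  [IsManifold I ∞ Q] {F : Type*} [NormedAddCommGroup F] [NormedSpace ℝ F]
  {E : Q → Type*} [∀ q, AddCommGroup (E q)] [∀ q, Module ℝ (E q)] [∀ q, TopologicalSpace (E q)]
  [∀ q, IsTopologicalAddGroup (E q)] [∀ q, ContinuousSMul ℝ (E q)]
  [TopologicalSpace (TotalSpace F E)] [FiberBundle F E] [VectorBundle ℝ F E]
  [ContMDiffVectorBundle ∞ F E I] (L : LieAlgebroid I F E)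

theorem bracket_antisymm (σ τ : Cₛ^∞⟮I; F, E⟯) : L.bracket σ τ = -L.bracket τ σ := by
  have h := L.bracket_self (σ + τ)
  simp only [map_add, LinearMap.add_apply, L.bracket_self, zero_add, add_zero] at h
  exact eq_neg_of_add_eq_zero_right h

theorem bracket_smul_right (σ τ : Cₛ^∞⟮I; F, E⟯) {f : Q → ℝ} (hf : ContMDiff I 𝓘(ℝ, ℝ) ∞ f)
    (q : Q) : L.bracket σ (smulSection f hf τ) q =
      f q • L.bracket σ τ q + dirDeriv f q (L.anchor q (σ q)) • τ q :=
  L.leibniz σ τ _ f hf (fun _ => rfl) q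

/-- Locality from Leibniz: with `χ` equal to 1 near `q` and supported where `τ` vanishes, `τ = (1 -
χ) τ`, and both `1 - χ` and `τ` vanish at `q`. -/
theorem bracket_right_eq_zero (σ : Cₛ^∞⟮I; F, E⟯) {τ : Cₛ^∞⟮I; F, E⟯} {q : Q}
    (h : ∀ᶠ x in 𝓝 q, τ x = 0) : L.bracket σ τ q = 0 := by
  obtain ⟨χ, hχ, h1, ht⟩ := exists_contMDiff_bump I h
  have hf : ContMDiff I 𝓘(ℝ, ℝ) ∞ fun x => 1 - χ x := contMDiff_const.sub hχ
  have : smulSection (fun x => 1 - χ x) hf τ = τ := by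
    ext x
    change (1 - χ x) • τ x = τ x
    by_cases hx : x ∈ tsupport χ
    · rw [show τ x = 0 from ht hx, smul_zero]
    · rw [image_eq_zero_of_notMem_tsupport hx, sub_zero, one_smul]
  rw [← this, bracket_smul_right, h.self_of_nhds, h1.self_of_nhds]
  simp

theorem bracket_congr_right (σ : Cₛ^∞⟮I; F, E⟯) {τ τ' : Cₛ^∞⟮I; F, E⟯} {q : Q}
    (h : ∀ᶠ x in 𝓝 q, τ x = τ' x) : L.bracket σ τ q = L.bracket σ τ' q := by
  have : L.bracket σ (τ - τ') q = 0 := L.bracket_right_eq_zero σ (h.mono fun x hx => by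
    rw [ContMDiffSection.coe_sub, Pi.sub_apply, hx, sub_self])
  rwa [map_sub, ContMDiffSection.coe_sub, Pi.sub_apply, sub_eq_zero] at this

theorem contMDiff_anchor (σ : Cₛ^∞⟮I; F, E⟯) : ContMDiff I I.tangent ∞
    (fun q => (⟨q, L.anchor q (σ q)⟩ : TangentBundle I Q)) :=
  L.anchor_smooth.comp σ.contMDiff

theorem contMDiff_anchor_dirDeriv (σ : Cₛ^∞⟮I; F, E⟯) {f : Q → ℝ}
    (hf : ContMDiff I 𝓘(ℝ, ℝ) ∞ f) :
    ContMDiff I 𝓘(ℝ, ℝ) ∞ fun q => dirDeriv f q (L.anchor q (σ q)) := by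
  rw [← contMDiffOn_univ]
  exact hf.contMDiffOn.dirDeriv isOpen_univ (L.contMDiff_anchor σ).contMDiffOn

/-- The anchor is a homomorphism of brackets. -/
theorem dirDeriv_anchor_bracket [FiniteDimensional ℝ F] (σ τ : Cₛ^∞⟮I; F, E⟯) {f : Q → ℝ}
    (hf : ContMDiff I 𝓘(ℝ, ℝ) ∞ f) (q : Q) :
    dirDeriv f q (L.anchor q (L.bracket σ τ q)) =
      dirDeriv (fun q' => dirDeriv f q' (L.anchor q' (τ q'))) q (L.anchor q (σ q)) -
        dirDeriv (fun q' => dirDeriv f q' (L.anchor q' (σ q'))) q (L.anchor q (τ q)) := by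
  -- The identity is obtained as the vanishing of a coefficient of some `υ q`, so a nonzero vector
  -- in the fibre is needed; over a zero fibre all terms vanish.
  by_cases htriv : ∀ a : E q, a = 0
  · rw [htriv (L.bracket σ τ q), htriv (σ q), htriv (τ q)]
    simp [dirDeriv_zero_vec]
  push Not at htriv
  obtain ⟨a, ha⟩ := htriv
  obtain ⟨υ, rfl⟩ := exists_contMDiffSection_apply_eq (I := I) (F := F) q a
  have hσ := L.contMDiff_anchor_dirDeriv σ hf
  have hτ := L.contMDiff_anchor_dirDeriv τ hf
  have e1 : ∀ (ζ : Cₛ^∞⟮I; F, E⟯) (hζ : ContMDiff I 𝓘(ℝ, ℝ) ∞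
      fun q => dirDeriv f q (L.anchor q (ζ q))), L.bracket ζ (smulSection f hf υ) =
      smulSection f hf (L.bracket ζ υ) + smulSection _ hζ υ := by
    intro ζ hζ
    ext x
    rw [bracket_smul_right]
    rfl
  have hj := L.jacobi σ τ (smulSection f hf υ)
  have hj0 := L.jacobi σ τ υ
  rw [L.bracket_antisymm (smulSection f hf υ) σ, L.bracket_antisymm (smulSection f hf υ), map_neg,
    e1 τ hτ, e1 σ hσ, map_add, map_add] at hj
  rw [L.bracket_antisymm υ σ, L.bracket_antisymm υ, map_neg] at hj0
  have hj' := congrArg (fun s : Cₛ^∞⟮I; F, E⟯ => s q) hj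
  have hj0' := congrArg (fun s : Cₛ^∞⟮I; F, E⟯ => f q • s q) hj0
  simp only [ContMDiffSection.coe_add, ContMDiffSection.coe_neg, Pi.add_apply, Pi.neg_apply,
    bracket_smul_right, ContMDiffSection.coe_zero, Pi.zero_apply, smul_zero] at hj' hj0'
  rw [← sub_eq_zero]
  refine (smul_eq_zero.1 (?_ : _ • υ q = 0)).resolve_right ha
  -- Jacobi for `(σ, τ, f υ)` minus `f` times Jacobi for `(σ, τ, υ)`: everything cancels except the
  -- defect of the anchor on `f`, multiplied by `υ q`.
  have := congrArg₂ (· - ·) hj' hj0'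
  simp only [sub_zero] at this
  rw [← neg_eq_zero, ← this]
  module

end LieAlgebroid

/-! ## Coefficients in local frames -/

section Frame

variable {HB : Type*} [TopologicalSpace HB] {EB : Type*} [NormedAddCommGroup EB] [NormedSpace ℝ EB]
  {I : ModelWithCorners ℝ EB HB} {Q : Type*} [TopologicalSpace Q] [ChartedSpace HB Q]
  [IsManifold I ∞ Q]
  {HM : Type*} [TopologicalSpace HM] {EM : Type*} [NormedAddCommGroup EM] [NormedSpace ℝ EM]
  {IM : ModelWithCorners ℝ EM HM} {M : Type*} [TopologicalSpace M] [ChartedSpace HM M]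
  {F : Type*} [NormedAddCommGroup F] [NormedSpace ℝ F] [FiniteDimensional ℝ F]
  {E : Q → Type*} [∀ q, AddCommGroup (E q)] [∀ q, Module ℝ (E q)] [∀ q, TopologicalSpace (E q)]
  [∀ q, IsTopologicalAddGroup (E q)] [∀ q, ContinuousSMul ℝ (E q)]
  [TopologicalSpace (TotalSpace F E)] [FiberBundle F E] [VectorBundle ℝ F E]
  [ContMDiffVectorBundle ∞ F E I]
  {ι : Type*} [Fintype ι] {e : ι → ∀ q, E q} {U : Set Q}

theorem IsLocalFrameOn.sum_coeff_smul (he : IsLocalFrameOn I F ∞ e U) {q : Q} (hq : q ∈ U)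
    (a : E q) : ∑ i, he.coeff i q a • e i q = a := by
  classical
  simpa using (he.coeff_sum_eq (Function.update (fun x => (0 : E x)) q a) hq).symm

theorem IsLocalFrameOn.coeff_self [DecidableEq ι] (he : IsLocalFrameOn I F ∞ e U) {q : Q}
    (hq : q ∈ U) (i j : ι) : he.coeff j q (e i q) = if i = j then 1 else 0 := by
  rw [← he.toBasisAt_coe hq]
  simp only [IsLocalFrameOn.coeff, hq, dite_true, Module.Basis.coord_apply,
    Module.Basis.repr_self, Finsupp.single_apply]

theorem IsLocalFrameOn.coeff_sum_smul (he : IsLocalFrameOn I F ∞ e U) {q : Q} (hq : q ∈ U)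
    (c : ι → ℝ) (j : ι) : he.coeff j q (∑ i, c i • e i q) = c j := by
  classical
  simp [map_sum, he.coeff_self hq]

/-- A coefficient in a local frame, as a continuous linear functional on the fibre. -/
def IsLocalFrameOn.coeffL (he : IsLocalFrameOn I F ∞ e U) (i : ι) (q : Q) : E q →L[ℝ] ℝ :=
  (LinearMap.toContinuousLinearMap
    (he.coeff i q ∘ₗ (fibreEquiv (E := E) F q).symm.toLinearEquiv.toLinearMap)).comp
    (fibreEquiv (E := E) F q).toContinuousLinearMap

theorem IsLocalFrameOn.coeffL_apply (he : IsLocalFrameOn I F ∞ e U) (i : ι) (q : Q) (a : E q) :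
    he.coeffL i q a = he.coeff i q a := by
  simp [IsLocalFrameOn.coeffL]

/-- The coefficients of a smooth section along a map are smooth. -/
theorem IsLocalFrameOn.contMDiffAt_coeff_along (he : IsLocalFrameOn I F ∞ e U) (hU : IsOpen U)
    {b : M → Q} {a : ∀ p, E (b p)} {p : M} (hp : b p ∈ U)
    (ha : ContMDiffAt IM (I.prod 𝓘(ℝ, F)) ∞ (fun p => TotalSpace.mk' F (b p) (a p)) p) (i : ι) :
    ContMDiffAt IM 𝓘(ℝ, ℝ) ∞ (fun p => he.coeff i (b p) (a p)) p := by
  let t := trivializationAt F E (b p)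
  have hpt : b p ∈ t.baseSet := mem_baseSet_trivializationAt F E (b p)
  have hb : ContMDiffAt IM I ∞ b p := (contMDiffAt_totalSpace.1 ha).1
  -- `A q` sends coefficients in the frame to the fibre coordinate in the trivialization. It is
  -- smooth in `q` and invertible, so the coefficients are smooth because inversion of linear maps
  -- is.
  let A : Q → (ι → ℝ) →L[ℝ] F := fun q =>
    ∑ j, (ContinuousLinearMap.proj j : (ι → ℝ) →L[ℝ] ℝ).smulRight (t ⟨q, e j q⟩).2
  have hA : ContMDiffAt I 𝓘(ℝ, (ι → ℝ) →L[ℝ] F) ∞ A (b p) := by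
    refine ContMDiffAt.sum fun j _ => ?_
    have h1 : ContMDiffAt I 𝓘(ℝ, F) ∞ (fun q => (t ⟨q, e j q⟩).2) (b p) :=
      (t.contMDiffAt_section_iff hpt).1 (he.contMDiffAt hU hp j)
    have h2 := (ContinuousLinearMap.smulRightL ℝ (ι → ℝ) F
      (ContinuousLinearMap.proj j)).contMDiff (n := ∞)
    exact h2.contMDiffAt.comp _ h1
  have hinv : ∀ q ∈ U ∩ t.baseSet, ∃ T : (ι → ℝ) ≃L[ℝ] F, (T : (ι → ℝ) →L[ℝ] F) = A q ∧
      ∀ a : E q, he.coeff i q a = T.symm (t ⟨q, a⟩).2 i := by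
    intro q hq
    let T := ((he.toBasisAt hq.1).equivFun.symm.trans (t.linearEquivAt ℝ q hq.2))
    refine ⟨T.toContinuousLinearEquiv, ?_, fun a => ?_⟩
    · ext c
      simp only [T, A, ContinuousLinearEquiv.coe_coe, LinearEquiv.coe_toContinuousLinearEquiv',
        LinearEquiv.trans_apply, Module.Basis.equivFun_symm_apply, map_sum, map_smul]
      simp
    · have : (t ⟨q, a⟩).2 = t.linearEquivAt ℝ q hq.2 a := by simp
      rw [this]
      simp only [IsLocalFrameOn.coeff, hq.1, dite_true]
      change _ = T.symm _ i
      simp [T, t.symm_apply_apply_mk hq.2 a]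
  have hW : ∀ᶠ p' in 𝓝 p, b p' ∈ U ∩ t.baseSet :=
    hb.continuousAt ((hU.inter t.open_baseSet).mem_nhds ⟨hp, hpt⟩)
  have h1 : ContMDiffAt IM 𝓘(ℝ, F →L[ℝ] (ι → ℝ)) ∞ (fun p' => (A (b p')).inverse) p := by
    obtain ⟨T, hT, -⟩ := hinv (b p) ⟨hp, hpt⟩
    have h := contDiffAt_map_inverse (𝕜 := ℝ) (n := ∞) T
    rw [hT] at h
    exact h.contMDiffAt.comp p (hA.comp p hb)
  have h2 : ContMDiffAt IM 𝓘(ℝ, F) ∞ (fun p' => (t ⟨b p', a p'⟩).2) p :=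
    (contMDiffAt_totalSpace.1 ha).2
  have h3 : ContMDiffAt IM 𝓘(ℝ, ι → ℝ) ∞ (fun p' => (A (b p')).inverse (t ⟨b p', a p'⟩).2) p :=
    h1.clm_apply h2
  refine ((contMDiffAt_pi_space.1 h3) i).congr_of_eventuallyEq ?_
  filter_upwards [hW] with p' hp'
  obtain ⟨T, hT, hc⟩ := hinv (b p') hp'
  rw [hc, ← hT, ContinuousLinearMap.inverse_equiv]
  rfl

/-- Global sections `g i` whose germs at `q` form a frame, with coefficient functionals `c i` on the
fibre at `q`. -/
def IsGermFrame (I : ModelWithCorners ℝ EB HB) {q : Q} (g : ι → Cₛ^∞⟮I; F, E⟯)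
    (c : ι → E q →L[ℝ] ℝ) : Prop :=
  ∀ σ : Cₛ^∞⟮I; F, E⟯, ∃ s : ι → Q → ℝ, (∀ i, ContMDiff I 𝓘(ℝ, ℝ) ∞ (s i)) ∧
    (∀ i, s i q = c i (σ q)) ∧ ∀ᶠ x in 𝓝 q, σ x = ∑ i, s i x • g i x

/-- The coefficients of `σ` are smooth only on `U`; global functions with the same germs at `q`
replace them, as Leibniz is stated for global functions. -/
theorem IsLocalFrameOn.isGermFrame [FiniteDimensional ℝ EB] [T2Space Q]
    (he : IsLocalFrameOn I F ∞ e U) (hU : IsOpen U)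
    {q : Q} (hq : q ∈ U) {g : ι → Cₛ^∞⟮I; F, E⟯} (hg : ∀ i, ∀ᶠ x in 𝓝 q, g i x = e i x) :
    IsGermFrame I g (fun i => he.coeffL i q) := by
  intro σ
  have h : ∀ i, ∃ f : Q → ℝ, ContMDiff I 𝓘(ℝ, ℝ) ∞ f ∧ f =ᶠ[𝓝 q] fun x => he.coeff i x (σ x) :=
    fun i => exists_contMDiff_eventuallyEq hU hq fun x hx =>
      (he.contMDiffAt_coeff_along hU (b := id) hx (σ.contMDiff x) i).contMDiffWithinAt
  choose s hs hse using h
  refine ⟨s, hs, fun i => ?_, ?_⟩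
  · rw [(hse i).self_of_nhds, he.coeffL_apply]
  · filter_upwards [hU.mem_nhds hq, Filter.eventually_all.2 hg, Filter.eventually_all.2 hse]
      with x hx hgx hsx
    simp only [hgx, hsx]
    exact (he.sum_coeff_smul hx (σ x)).symm

theorem IsLocalFrameOn.exists_germ_extension [FiniteDimensional ℝ EB] [T2Space Q]
    (he : IsLocalFrameOn I F ∞ e U) (hU : IsOpen U) {q : Q} (hq : q ∈ U) :
    ∃ g : ι → Cₛ^∞⟮I; F, E⟯, ∀ i, ∀ᶠ x in 𝓝 q, g i x = e i x := by
  choose g hg using fun i => exists_contMDiffSection_eventuallyEq hU hq (he.contMDiffOn i)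
  exact ⟨g, hg⟩

variable (I F E) in
theorem exists_isGermFrame [FiniteDimensional ℝ EB] [T2Space Q] (q : Q) :
    ∃ (g : Fin (Module.finrank ℝ F) → Cₛ^∞⟮I; F, E⟯)
      (c : Fin (Module.finrank ℝ F) → E q →L[ℝ] ℝ), IsGermFrame I g c := by
  let t := trivializationAt F E q
  have hfr := t.isLocalFrameOn_localFrame_baseSet I ∞ (Module.finBasis ℝ F)
  have hq := mem_baseSet_trivializationAt F E q
  obtain ⟨g, hg⟩ := hfr.exists_germ_extension t.open_baseSet hq
  exact ⟨g, _, hfr.isGermFrame t.open_baseSet hq hg⟩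

/-- The bracket of two sections in terms of their coefficients in a frame. -/
theorem LieAlgebroid.bracket_eq_sum [FiniteDimensional ℝ EB] [T2Space Q] (L : LieAlgebroid I F E)
    {σ τ : Cₛ^∞⟮I; F, E⟯} {g : ι → Cₛ^∞⟮I; F, E⟯} {s u : ι → Q → ℝ} {q : Q}
    (hs : ∀ i, ContMDiff I 𝓘(ℝ, ℝ) ∞ (s i)) (hu : ∀ i, ContMDiff I 𝓘(ℝ, ℝ) ∞ (u i))
    (hσ : ∀ᶠ x in 𝓝 q, σ x = ∑ i, s i x • g i x) (hτ : ∀ᶠ x in 𝓝 q, τ x = ∑ i, u i x • g i x) :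
    L.bracket σ τ q = ∑ i, ∑ j, (s i q * u j q) • L.bracket (g i) (g j) q +
      ∑ j, dirDeriv (u j) q (L.anchor q (σ q)) • g j q -
      ∑ i, dirDeriv (s i) q (L.anchor q (τ q)) • g i q := by
  have coe_sum : ∀ (f : ι → Cₛ^∞⟮I; F, E⟯) (x : Q), (∑ i, f i : Cₛ^∞⟮I; F, E⟯) x = ∑ i, f i x := by
    intro f x
    have := map_sum (ContMDiffSection.coeAddHom I F ∞ E) f Finset.univ
    have h2 := congrFun this x
    rwa [Finset.sum_apply] at h2
  have expand : ∀ (υ : Cₛ^∞⟮I; F, E⟯) (w : ι → Q → ℝ) (hw : ∀ i, ContMDiff I 𝓘(ℝ, ℝ) ∞ (w i))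
      (ζ : Cₛ^∞⟮I; F, E⟯), (∀ᶠ x in 𝓝 q, ζ x = ∑ i, w i x • g i x) →
      L.bracket υ ζ q = ∑ j, w j q • L.bracket υ (g j) q +
        ∑ j, dirDeriv (w j) q (L.anchor q (υ q)) • g j q := by
    intro υ w hw ζ hζ
    have h : ∀ᶠ x in 𝓝 q, ζ x = (∑ j, smulSection (w j) (hw j) (g j) : Cₛ^∞⟮I; F, E⟯) x := by
      filter_upwards [hζ] with x hx
      rw [hx, coe_sum]
      rfl
    rw [L.bracket_congr_right υ h, map_sum, coe_sum, ← Finset.sum_add_distrib]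
    exact Finset.sum_congr rfl fun j _ => L.bracket_smul_right _ _ _ _
  -- Leibniz acts on the second slot only; the first slot is expanded through antisymmetry.
  have hanti : ∀ j, L.bracket σ (g j) q = ∑ i, s i q • L.bracket (g i) (g j) q -
      ∑ i, dirDeriv (s i) q (L.anchor q (g j q)) • g i q := by
    intro j
    rw [L.bracket_antisymm, ContMDiffSection.coe_neg, Pi.neg_apply, expand (g j) s hs σ hσ, neg_add,
      ← sub_eq_add_neg, ← Finset.sum_neg_distrib]
    congr 1
    refine Finset.sum_congr rfl fun i _ => ?_
    rw [L.bracket_antisymm (g j), ContMDiffSection.coe_neg, Pi.neg_apply, smul_neg, neg_neg]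
  rw [expand σ u hu τ hτ]
  simp only [hanti, smul_sub, Finset.smul_sum, Finset.sum_sub_distrib]
  rw [Finset.sum_comm, sub_add_eq_add_sub]
  congr 1
  · simp only [smul_smul, mul_comm]
  · rw [Finset.sum_comm]
    refine Finset.sum_congr rfl fun i _ => ?_
    simp only [smul_smul, ← Finset.sum_smul]
    -- The anchors of the `g j`, weighted by `u j q`, add up to the anchor of `τ q`.
    rw [hτ.self_of_nhds, map_sum, dirDeriv_sum_vec]
    simp only [map_smul, dirDeriv_smul_vec]

end Frame

/-! ## Forms of degree at most two on prolongations -/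

theorem koszul_zero_degree {S M : Type*} (D : S → (M → ℝ) → M → ℝ) (br : S → S → S)
    (μ : (Fin 0 → S) → M → ℝ) (Z : Fin 1 → S) (p : M) :
    koszul D br μ Z p = D (Z 0) (μ ![]) p := by
  have h : ∀ Y : Fin 0 → S, Y = ![] := fun Y => Subsingleton.elim _ _
  simp [koszul, h (Fin.tail Z)]

theorem koszul_one {S M : Type*} (D : S → (M → ℝ) → M → ℝ) (br : S → S → S)
    (μ : (Fin 1 → S) → M → ℝ) (Z : Fin 2 → S) (p : M) :
    koszul D br μ Z p = D (Z 0) (μ fun _ => Z 1) p - D (Z 1) (μ fun _ => Z 0) p -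
      μ (fun _ => br (Z 0) (Z 1)) p := by
  have h0 : (0 : Fin 2).removeNth Z = fun _ => Z 1 := by ext i; fin_cases i; rfl
  have h1 : (1 : Fin 2).removeNth Z = fun _ => Z 0 := by ext i; fin_cases i; rfl
  have h2 : Function.update (fun _ : Fin 1 => Z 0) 0 (br (Z 0) (Z 1)) =
      fun _ => br (Z 0) (Z 1) := by ext i; fin_cases i; rfl
  unfold koszul
  rw [Fin.sum_univ_two, Fin.sum_univ_two, h0, h1]
  simp [h2]
  ring

/-- The wedge product of two continuous linear functionals. -/
def wedge {V : Type*} [AddCommGroup V] [Module ℝ V] [TopologicalSpace V] (f g : V →L[ℝ] ℝ) :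
    V [⋀^Fin 2]→L[ℝ] ℝ :=
  ContinuousMultilinearMap.alternatization
    ((ContinuousMultilinearMap.mkPiAlgebra ℝ (Fin 2) ℝ).compContinuousLinearMap ![f, g])

theorem wedge_apply {V : Type*} [AddCommGroup V] [Module ℝ V] [TopologicalSpace V]
    (f g : V →L[ℝ] ℝ) (v : Fin 2 → V) : wedge f g v = f (v 0) * g (v 1) - f (v 1) * g (v 0) := by
  have hu : (Finset.univ : Finset (Equiv.Perm (Fin 2))) = {1, Equiv.swap 0 1} := by decide
  rw [wedge, ContinuousMultilinearMap.alternatization_apply_apply, hu,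
    Finset.sum_pair (by decide)]
  simp [Fin.prod_univ_two]
  ring

section Prolongation

variable {HB : Type*} [TopologicalSpace HB] {EB : Type*} [NormedAddCommGroup EB] [NormedSpace ℝ EB]
  [FiniteDimensional ℝ EB]
  {I : ModelWithCorners ℝ EB HB} {Q : Type*} [TopologicalSpace Q] [ChartedSpace HB Q] [T2Space Q]
  {F : Type*} [NormedAddCommGroup F] [NormedSpace ℝ F] [FiniteDimensional ℝ F]
  {E : Q → Type*} [∀ q, AddCommGroup (E q)] [∀ q, Module ℝ (E q)] [∀ q, TopologicalSpace (E q)]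
  [∀ q, IsTopologicalAddGroup (E q)] [∀ q, ContinuousSMul ℝ (E q)]
  [TopologicalSpace (TotalSpace F E)] [FiberBundle F E] [VectorBundle ℝ F E]
  [IsManifold I ∞ Q] [ContMDiffVectorBundle ∞ F E I]
  (L : LieAlgebroid I F E)
  {HM : Type*} [TopologicalSpace HM] {EM : Type*} [NormedAddCommGroup EM] [NormedSpace ℝ EM]
  [CompleteSpace EM]
  {IM : ModelWithCorners ℝ EM HM} [IM.Boundaryless]
  {M : Type*} [TopologicalSpace M] [ChartedSpace HM M]
  [IsManifold IM ∞ M] {pr : M → Q}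

variable {L} in
theorem IsProjectableOn.coe_eval {Z : PreSection I F E IM M} {V : Set M}
    (hZ : IsProjectableOn L IM pr Z V) {p : M} (hp : p ∈ V) :
    (Z.eval L IM pr p : E (pr p) × TangentSpace IM p) = (Z.1 (pr p), Z.2 p) := by
  have h : (Z.1 (pr p), Z.2 p) ∈ ProlongFiber L IM pr p := hZ.2 p hp
  rw [PreSection.eval, dif_pos h]

variable {L} in
-- Since `eval` is zero off the prolongation, the pair of brackets has to be shown to lie in it.
-- Both $\rho([\sigma,\sigma'])$ and $T\pi([X,X'])$ act on functions of the base as commutators of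
-- related derivations, and functions separate tangent vectors.
theorem IsProjectableOn.coe_eval_bracket (hpr : ContMDiff IM I ∞ pr) {Z W : PreSection I F E IM M}
    {V : Set M} (hV : IsOpen V) (hZ : IsProjectableOn L IM pr Z V)
    (hW : IsProjectableOn L IM pr W V) {p : M} (hp : p ∈ V) :
    ((PreSection.bracket L IM Z W).eval L IM pr p : E (pr p) × TangentSpace IM p) =
      (L.bracket Z.1 W.1 (pr p), VectorField.mlieBracket IM Z.2 W.2 p) := by
  have hmd : ∀ x, MDifferentiableAt IM I pr x := fun x => (hpr x).mdifferentiableAt (by simp)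
  have rel : ∀ (Y : PreSection I F E IM M), IsProjectableOn L IM pr Y V → ∀ (f : Q → ℝ),
      ContMDiff I 𝓘(ℝ, ℝ) ∞ f → ∀ x ∈ V, dirDeriv (fun x => f (pr x)) x (Y.2 x) =
        dirDeriv f (pr x) (L.anchor (pr x) (Y.1 (pr x))) := fun Y hY f hf x hx => by
    rw [dirDeriv_comp ((hf _).mdifferentiableAt (by simp)) (hmd x), hY.2 x hx]
  have hmem : L.anchor (pr p) (L.bracket Z.1 W.1 (pr p)) =
      mfderiv IM I pr p (VectorField.mlieBracket IM Z.2 W.2 p) := by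
    refine eq_of_dirDeriv_eq fun f hf => ?_
    rw [← dirDeriv_comp ((hf _).mdifferentiableAt (by simp)) (hmd p),
      dirDeriv_mlieBracket (f := fun x => f (pr x)) hV (hf.comp hpr).contMDiffOn hZ.1 hW.1 hp,
      L.dirDeriv_anchor_bracket _ _ hf]
    have key : ∀ Y Y' : PreSection I F E IM M, IsProjectableOn L IM pr Y V →
        IsProjectableOn L IM pr Y' V →
        dirDeriv (fun p' => dirDeriv (fun x => f (pr x)) p' (Y'.2 p')) p (Y.2 p) =
        dirDeriv (fun q' => dirDeriv f q' (L.anchor q' (Y'.1 q'))) (pr p)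
          (L.anchor (pr p) (Y.1 (pr p))) := by
      intro Y Y' hY hY'
      rw [← rel Y hY _ (L.contMDiff_anchor_dirDeriv Y'.1 hf) p hp]
      exact dirDeriv_congr (Filter.eventuallyEq_of_mem (hV.mem_nhds hp)
        fun x hx => rel Y' hY' f hf x hx) _
    rw [← key Z W hZ hW, ← key W Z hW hZ]
  have h : ((PreSection.bracket L IM Z W).1 (pr p), (PreSection.bracket L IM Z W).2 p) ∈
      ProlongFiber L IM pr p := hmem
  rw [PreSection.eval, dif_pos h]
  rfl

/-- A family of functionals on the fibres `E (pr p)` is smooth if its values on sections are. -/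
def SmoothFunctional (IM : ModelWithCorners ℝ EM HM) (I : ModelWithCorners ℝ EB HB) (F : Type*)
    [NormedAddCommGroup F] [NormedSpace ℝ F] {E : Q → Type*} [∀ q, AddCommGroup (E q)]
    [∀ q, Module ℝ (E q)] [∀ q, TopologicalSpace (E q)] [TopologicalSpace (TotalSpace F E)]
    [FiberBundle F E] [VectorBundle ℝ F E]
    {pr : M → Q} (ℓ : ∀ p : M, E (pr p) →L[ℝ] ℝ) : Prop :=
  ∀ σ : Cₛ^∞⟮I; F, E⟯, ContMDiff IM 𝓘(ℝ, ℝ) ∞ fun p => ℓ p (σ (pr p))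

/-- The Koszul expression of a family of functionals, in terms of coefficients in a frame. -/
theorem SmoothFunctional.koszul_eq (hpr : ContMDiff IM I ∞ pr) {ℓ : ∀ p : M, E (pr p) →L[ℝ] ℝ}
    (hℓ : SmoothFunctional IM I F ℓ) {p : M} {ι : Type} [Fintype ι]
    {g : ι → Cₛ^∞⟮I; F, E⟯} {c : ι → E (pr p) →L[ℝ] ℝ} (hg : IsGermFrame I g c)
    (σ τ : Cₛ^∞⟮I; F, E⟯) (v w : TangentSpace IM p)
    (hv : L.anchor (pr p) (σ (pr p)) = mfderiv IM I pr p v)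
    (hw : L.anchor (pr p) (τ (pr p)) = mfderiv IM I pr p w) :
    dirDeriv (fun x => ℓ x (τ (pr x))) p v - dirDeriv (fun x => ℓ x (σ (pr x))) p w -
        ℓ p (L.bracket σ τ (pr p)) =
      ∑ i, (c i (τ (pr p)) * dirDeriv (fun x => ℓ x (g i (pr x))) p v -
        c i (σ (pr p)) * dirDeriv (fun x => ℓ x (g i (pr x))) p w) -
      ∑ i, ∑ j, c i (σ (pr p)) * c j (τ (pr p)) * ℓ p (L.bracket (g i) (g j) (pr p)) := by
  obtain ⟨s, hs, hsc, hσ⟩ := hg σ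
  obtain ⟨u, hu, huc, hτ⟩ := hg τ
  have hmd : MDifferentiableAt IM I pr p := (hpr p).mdifferentiableAt (by simp)
  have key : ∀ (υ ζ : Cₛ^∞⟮I; F, E⟯) (r : ι → Q → ℝ) (y : TangentSpace IM p),
      (∀ i, ContMDiff I 𝓘(ℝ, ℝ) ∞ (r i)) → (∀ᶠ x in 𝓝 (pr p), ζ x = ∑ i, r i x • g i x) →
      L.anchor (pr p) (υ (pr p)) = mfderiv IM I pr p y →
      dirDeriv (fun x => ℓ x (ζ (pr x))) p y =
        ∑ i, (r i (pr p) * dirDeriv (fun x => ℓ x (g i (pr x))) p y +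
          ℓ p (g i (pr p)) * dirDeriv (r i) (pr p) (L.anchor (pr p) (υ (pr p)))) := by
    intro υ ζ r y hr hζ hy
    have h1 : (fun x => ℓ x (ζ (pr x))) =ᶠ[𝓝 p]
        fun x => ∑ i, r i (pr x) * ℓ x (g i (pr x)) := by
      filter_upwards [hpr.continuous.continuousAt.eventually hζ] with x hx
      rw [hx, map_sum]
      simp
    have h2 : ∀ i, MDifferentiableAt IM 𝓘(ℝ, ℝ) (fun x => r i (pr x)) p := fun i =>
      (((hr i).comp hpr) p).mdifferentiableAt (by simp)
    have h3 : ∀ i, MDifferentiableAt IM 𝓘(ℝ, ℝ) (fun x => ℓ x (g i (pr x))) p := fun i =>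
      (hℓ (g i) p).mdifferentiableAt (by simp)
    rw [dirDeriv_congr h1, dirDeriv_sum (f := fun i x => r i (pr x) * ℓ x (g i (pr x))) _ fun i _ =>
      (((hr i).comp hpr p).mul (hℓ (g i) p)).mdifferentiableAt (by simp)]
    refine Finset.sum_congr rfl fun i _ => ?_
    rw [dirDeriv_mul (h2 i) (h3 i), hy,
      dirDeriv_comp ((hr i _).mdifferentiableAt (by simp)) hmd]
  -- The derivatives of the coefficients `s` and `u` produced by the product rule cancel those
  -- contained in the bracket. Only values at `p` survive, which is tensoriality.
  rw [key σ τ u v hu hτ hv, key τ σ s w hs hσ hw, L.bracket_eq_sum hs hu hσ hτ, map_sub, map_add]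
  simp only [map_sum, map_smul, smul_eq_mul, ← hsc, ← huc, Finset.sum_add_distrib,
    Finset.sum_sub_distrib, mul_comm (ℓ p (g _ (pr p)))]
  ring

/-- The `1`-section `(a, v) ↦ ℓ_p(a)` of the dual of the prolongation. -/
def ProlongForm.ofFunctional (ℓ : ∀ p : M, E (pr p) →L[ℝ] ℝ) : ProlongForm L IM pr 1 := fun p =>
  ContinuousAlternatingMap.ofSubsingleton ℝ _ ℝ (0 : Fin 1)
    ((ℓ p).comp ((ContinuousLinearMap.fst ℝ _ _).comp (ProlongFiber L IM pr p).subtypeL))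

theorem ProlongForm.ofFunctional_apply (ℓ : ∀ p : M, E (pr p) →L[ℝ] ℝ) (p : M)
    (z : Fin 1 → ProlongFiber L IM pr p) :
    ProlongForm.ofFunctional L (IM := IM) ℓ p z = ℓ p (z 0).1.1 := rfl

theorem ProlongForm.smooth_ofFunctional {ℓ : ∀ p : M, E (pr p) →L[ℝ] ℝ}
    (hℓ : SmoothFunctional IM I F ℓ) : (ProlongForm.ofFunctional L (IM := IM) ℓ).Smooth L := by
  intro V Z _ hZ
  refine (hℓ (Z 0).1).contMDiffOn.congr fun p hp => ?_
  rw [ProlongForm.ofFunctional_apply, (hZ 0).coe_eval hp]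

theorem ProlongForm.koszul_ofFunctional (hpr : ContMDiff IM I ∞ pr)
    (ℓ : ∀ p : M, E (pr p) →L[ℝ] ℝ) {p : M} {V : Set M} (hV : IsOpen V) (hp : p ∈ V)
    {Z : Fin 2 → PreSection I F E IM M} (hZ : ∀ i, IsProjectableOn L IM pr (Z i) V) :
    koszul (fun Z f p => dirDeriv f p (Z.2 p)) (PreSection.bracket L IM)
        (fun Z p => ProlongForm.ofFunctional L (IM := IM) ℓ p fun i => (Z i).eval L IM pr p) Z p =
      dirDeriv (fun x => ℓ x ((Z 1).1 (pr x))) p ((Z 0).2 p) -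
        dirDeriv (fun x => ℓ x ((Z 0).1 (pr x))) p ((Z 1).2 p) -
        ℓ p (L.bracket (Z 0).1 (Z 1).1 (pr p)) := by
  rw [koszul_one]
  simp only [ProlongForm.ofFunctional_apply, (hZ 0).coe_eval_bracket hpr hV (hZ 1) hp]
  have h : ∀ i, (fun x => ℓ x ((Z i).eval L IM pr x).1.1) =ᶠ[𝓝 p]
      fun x => ℓ x ((Z i).1 (pr x)) := fun i =>
    Filter.eventuallyEq_of_mem (hV.mem_nhds hp) fun x hx => by
      simp only [(hZ i).coe_eval hx]
  rw [dirDeriv_congr (h 0), dirDeriv_congr (h 1)]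

/-- `ProlongForm.d` is zero by default unless some form satisfies the Koszul formula, so one is
exhibited from the frame expression of `SmoothFunctional.koszul_eq`. The frame may be chosen
separately at each point, as no smoothness of the form is asked for. -/
theorem ProlongForm.exists_isExtDeriv_ofFunctional (hpr : ContMDiff IM I ∞ pr)
    {ℓ : ∀ p : M, E (pr p) →L[ℝ] ℝ} (hℓ : SmoothFunctional IM I F ℓ) :
    ∃ η, (ProlongForm.ofFunctional L (IM := IM) ℓ).IsExtDeriv L η := by
  choose g c hg using fun p : M => exists_isGermFrame I F E (pr p)
  let fstL : ∀ p, ProlongFiber L IM pr p →L[ℝ] E (pr p) := fun p =>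
    (ContinuousLinearMap.fst ℝ _ _).comp (ProlongFiber L IM pr p).subtypeL
  let sndL : ∀ p, ProlongFiber L IM pr p →L[ℝ] TangentSpace IM p := fun p =>
    (ContinuousLinearMap.snd ℝ _ _).comp (ProlongFiber L IM pr p).subtypeL
  let dℓ : ∀ p, Fin (Module.finrank ℝ F) → TangentSpace IM p →L[ℝ] ℝ := fun p i =>
    mfderiv IM 𝓘(ℝ, ℝ) (fun x => ℓ x (g p i (pr x))) p
  -- The factor 1/2 appears because the double sum runs over ordered pairs and both the bracket and
  -- the wedge are antisymmetric.
  refine ⟨fun p => ∑ i, wedge ((dℓ p i).comp (sndL p)) ((c p i).comp (fstL p)) -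
    ∑ i, ∑ j, (ℓ p (L.bracket (g p i) (g p j) (pr p)) / 2) •
      wedge ((c p i).comp (fstL p)) ((c p j).comp (fstL p)), ?_⟩
  intro p V Z hV hp hZ
  rw [ProlongForm.koszul_ofFunctional L hpr ℓ hV hp hZ,
    hℓ.koszul_eq L hpr (hg p) _ _ _ _ ((hZ 0).2 p hp) ((hZ 1).2 p hp)]
  have hanti : ∀ i j, ℓ p (L.bracket (g p i) (g p j) (pr p)) =
      -ℓ p (L.bracket (g p j) (g p i) (pr p)) := fun i j => by
    rw [L.bracket_antisymm, ContMDiffSection.coe_neg, Pi.neg_apply, map_neg]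
  simp only [ContinuousAlternatingMap.sub_apply, ContinuousAlternatingMap.sum_apply,
    ContinuousAlternatingMap.smul_apply, wedge_apply, smul_eq_mul]
  have h0 := (hZ 0).coe_eval hp
  have h1 := (hZ 1).coe_eval hp
  have f0 : fstL p ((Z 0).eval L IM pr p) = (Z 0).1 (pr p) := congrArg Prod.fst h0
  have f1 : fstL p ((Z 1).eval L IM pr p) = (Z 1).1 (pr p) := congrArg Prod.fst h1
  have s0 : sndL p ((Z 0).eval L IM pr p) = (Z 0).2 p := congrArg Prod.snd h0
  have s1 : sndL p ((Z 1).eval L IM pr p) = (Z 1).2 p := congrArg Prod.snd h1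
  simp only [ContinuousLinearMap.comp_apply, f0, f1, s0, s1]
  congr 1
  · refine Finset.sum_congr rfl fun i _ => ?_
    change dirDeriv _ p _ * _ - dirDeriv _ p _ * _ = _
    ring
  -- A double sum is unchanged when its summand is symmetrised; this absorbs the factor 1/2.
  · have : ∀ a b : Fin (Module.finrank ℝ F) → Fin (Module.finrank ℝ F) → ℝ,
        (∀ i j, a i j = (b i j + b j i) / 2) → ∑ i, ∑ j, a i j = ∑ i, ∑ j, b i j := by
      intro a b hab
      simp only [hab, ← Finset.sum_div, Finset.sum_add_distrib]
      rw [Finset.sum_comm (f := fun i j => b j i)]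
      ring
    refine this _ _ fun i j => ?_
    rw [hanti j i]
    ring

theorem ProlongForm.d_isExtDeriv {l : ℕ} {μ : ProlongForm L IM pr l}
    (h : ∃ η, μ.IsExtDeriv L η) : μ.IsExtDeriv L (μ.d L) := by
  rw [ProlongForm.d, dif_pos h]
  exact h.choose_spec

theorem KProlongForm.d_isExtDeriv {k l : ℕ} {A : Fin k} {μ : KProlongForm L IM pr k l}
    (h : ∃ η, μ.IsExtDeriv L A η) : μ.IsExtDeriv L A (μ.d L A) := by
  rw [KProlongForm.d, dif_pos h]
  exact h.choose_spec

/-- Functions, as forms of degree zero. -/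
def ProlongForm.ofFunction (f : M → ℝ) : ProlongForm L IM pr 0 := fun p =>
  ContinuousAlternatingMap.constOfIsEmpty ℝ _ (Fin 0) (f p)

theorem ProlongForm.smooth_ofFunction {f : M → ℝ} (hf : ContMDiff IM 𝓘(ℝ, ℝ) ∞ f) :
    (ProlongForm.ofFunction L (IM := IM) (pr := pr) f).Smooth L := fun _ _ _ _ => hf.contMDiffOn

theorem ProlongForm.exists_isExtDeriv_ofFunction (f : M → ℝ) :
    ∃ η, (ProlongForm.ofFunction L (IM := IM) (pr := pr) f).IsExtDeriv L η := by
  refine ⟨fun p => ContinuousAlternatingMap.ofSubsingleton ℝ _ ℝ (0 : Fin 1)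
    (ContinuousLinearMap.comp (mfderiv IM 𝓘(ℝ, ℝ) f p : TangentSpace IM p →L[ℝ] ℝ)
      ((ContinuousLinearMap.snd ℝ _ _).comp (ProlongFiber L IM pr p).subtypeL)), ?_⟩
  intro p V Z hV hp hZ
  rw [koszul_zero_degree]
  change mfderiv IM 𝓘(ℝ, ℝ) f p ((Z 0).eval L IM pr p).1.2 = _
  rw [(hZ 0).coe_eval hp]
  rfl

/-- The `1`-section `z ↦ ℓ_p(a_A)` of the dual of the `k`-prolongation. -/
def KProlongForm.ofFunctional {k : ℕ} (A : Fin k) (ℓ : ∀ p : M, E (pr p) →L[ℝ] ℝ) :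
    KProlongForm L IM pr k 1 := fun p =>
  (ProlongForm.ofFunctional L (IM := IM) ℓ p).compContinuousLinearMap (ContinuousLinearMap.proj A)

/-- Both the action on functions and the componentwise bracket see only the `A`-th entries, so $d^A$
on these forms reduces to the differential of $\mathcal T^EM$. -/
theorem KProlongForm.koszul_ofFunctional {k : ℕ} (A : Fin k) (ℓ : ∀ p : M, E (pr p) →L[ℝ] ℝ) 
    (Z : Fin 2 → Fin k → PreSection I F E IM M) (p : M) :
    koszul (fun Z f p => dirDeriv f p ((Z A).2 p))
        (fun Z Z' B => PreSection.bracket L IM (Z B) (Z' B))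
        (fun Z p => KProlongForm.ofFunctional L A ℓ p fun i B => (Z i B).eval L IM pr p) Z p =
      koszul (fun Z f p => dirDeriv f p (Z.2 p)) (PreSection.bracket L IM)
        (fun Z p => ProlongForm.ofFunctional L (IM := IM) ℓ p fun i => (Z i).eval L IM pr p)
        (fun i => Z i A) p := by
  rw [koszul_one, koszul_one]
  rfl

theorem KProlongForm.exists_isExtDeriv_ofFunctional (hpr : ContMDiff IM I ∞ pr) {k : ℕ} (A : Fin k)
    {ℓ : ∀ p : M, E (pr p) →L[ℝ] ℝ} (hℓ : SmoothFunctional IM I F ℓ) :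
    ∃ η, (KProlongForm.ofFunctional L (IM := IM) A ℓ).IsExtDeriv L A η := by
  obtain ⟨η, hη⟩ := ProlongForm.exists_isExtDeriv_ofFunctional L hpr hℓ
  refine ⟨fun p => (η p).compContinuousLinearMap (ContinuousLinearMap.proj A), ?_⟩
  intro p V Z hV hp hZ
  rw [KProlongForm.koszul_ofFunctional, ← hη p V _ hV hp fun i => hZ i A]
  rfl

end Prolongation

/-! ## Coordinates on the phase space -/

section Smoothness

variable {HM : Type*} [TopologicalSpace HM] {EM : Type*} [NormedAddCommGroup EM] [NormedSpace ℝ EM]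
  {IM : ModelWithCorners ℝ EM HM} {M : Type*} [TopologicalSpace M] [ChartedSpace HM M]

theorem contMDiffAt_clm_of_apply {F G : Type*} [NormedAddCommGroup F] [NormedSpace ℝ F]
    [FiniteDimensional ℝ F] [NormedAddCommGroup G] [NormedSpace ℝ G] {f : M → F →L[ℝ] G} {p : M}
    (h : ∀ v, ContMDiffAt IM 𝓘(ℝ, G) ∞ (fun x => f x v) p) :
    ContMDiffAt IM 𝓘(ℝ, F →L[ℝ] G) ∞ f p := by
  let b := Module.finBasis ℝ F
  have hf : f = fun x => ∑ i,
      ContinuousLinearMap.smulRightL ℝ F G (LinearMap.toContinuousLinearMap (b.coord i))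
        (f x (b i)) := by
    ext x v
    conv_lhs => rw [← b.sum_repr v, map_sum]
    simp
  rw [hf]
  exact ContMDiffAt.sum fun i _ =>
    ((ContinuousLinearMap.smulRightL ℝ F G _).contMDiff (n := ∞)).contMDiffAt.comp _ (h (b i))

theorem contMDiffAt_trivial_snd {HB : Type*} [TopologicalSpace HB] {EB : Type*}
    [NormedAddCommGroup EB] [NormedSpace ℝ EB] {I : ModelWithCorners ℝ EB HB} {Q : Type*}
    [TopologicalSpace Q] [ChartedSpace HB Q] {G : Type*} [NormedAddCommGroup G] [NormedSpace ℝ G]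
    {b : M → Q} {g : M → G} {p : M}
    (h : ContMDiffAt IM (I.prod 𝓘(ℝ, G)) ∞
      (fun x => TotalSpace.mk' G (E := Bundle.Trivial Q G) (b x) (g x)) p) :
    ContMDiffAt IM 𝓘(ℝ, G) ∞ g p := (contMDiffAt_totalSpace.1 h).2

end Smoothness

/-! ### Smoothness of the projection and of the momenta -/

section Phase

variable {HB : Type*} [TopologicalSpace HB] {EB : Type*} [NormedAddCommGroup EB] [NormedSpace ℝ EB]
  {I : ModelWithCorners ℝ EB HB} {Q : Type*} [TopologicalSpace Q] [ChartedSpace HB Q]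
  {F : Type*} [NormedAddCommGroup F] [NormedSpace ℝ F]
  {E : Q → Type*} [∀ q, AddCommGroup (E q)] [∀ q, Module ℝ (E q)] [∀ q, TopologicalSpace (E q)]
  [∀ q, IsTopologicalAddGroup (E q)] [∀ q, ContinuousSMul ℝ (E q)]
  [TopologicalSpace (TotalSpace F E)] [FiberBundle F E] [VectorBundle ℝ F E]
  [IsManifold I ∞ Q] [ContMDiffVectorBundle ∞ F E I] {k : ℕ}

theorem contMDiff_phaseProj : ContMDiff (phaseModel k I F) I ∞ (phaseProj k F E) :=
  (contMDiff_proj _).comp contMDiff_snd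

theorem contMDiffAt_covector_apply {s : ∀ q, E q} {p : PhaseSpace k F E}
    (hs : ContMDiffAt I (I.prod 𝓘(ℝ, F)) ∞ (fun q => TotalSpace.mk' F q (s q)) (phaseProj k F E p))
    (A : Fin k) : ContMDiffAt (phaseModel k I F) 𝓘(ℝ, ℝ) ∞
      (fun p' : PhaseSpace k F E => covector p' A (s (phaseProj k F E p'))) p := by
  have h1 : ContMDiffAt (phaseModel k I F) (I.prod 𝓘(ℝ, F →L[ℝ] (Fin k → ℝ))) ∞
      (fun p' : PhaseSpace k F E => TotalSpace.mk' (F →L[ℝ] (Fin k → ℝ))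
        (E := fun q => E q →L[ℝ] Bundle.Trivial Q (Fin k → ℝ) q) p'.2.1 p'.2.2) p :=
    contMDiffAt_snd
  have h2 := h1.clm_bundle_apply (hs.comp p (contMDiff_phaseProj p))
  exact contMDiffAt_pi_space.1 (contMDiffAt_trivial_snd h2) A

theorem smoothFunctional_covector (A : Fin k) :
    SmoothFunctional (phaseModel k I F) I F (fun p : PhaseSpace k F E => covector p A) :=
  fun σ _ => contMDiffAt_covector_apply (σ.contMDiff _) A

end Phase

/-! ### The coordinate map of the phase space and its inverse -/

section Coordinates

variable {n : ℕ} {Q : Type*} [TopologicalSpace Q] [ChartedSpace (EuclideanSpace ℝ (Fin n)) Q]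
  [T2Space Q]
  {F : Type*} [NormedAddCommGroup F] [NormedSpace ℝ F] [FiniteDimensional ℝ F]
  {E : Q → Type*} [∀ q, AddCommGroup (E q)] [∀ q, Module ℝ (E q)] [∀ q, TopologicalSpace (E q)]
  [∀ q, IsTopologicalAddGroup (E q)] [∀ q, ContinuousSMul ℝ (E q)]
  [TopologicalSpace (TotalSpace F E)] [FiberBundle F E] [VectorBundle ℝ F E]
  [IsManifold (𝓡 n) ∞ Q] [ContMDiffVectorBundle ∞ F E (𝓡 n)]
  (L : LieAlgebroid (𝓡 n) F E) {k m : ℕ}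
  {φ : OpenPartialHomeomorph Q (EuclideanSpace ℝ (Fin n))}
  {e : Fin m → ∀ q, E q}

/-- The values of the coordinates `(t^A, q^i, y_α^A)`. -/
abbrev CoordSpace (n m k : ℕ) : Type :=
  (Fin k → ℝ) × EuclideanSpace ℝ (Fin n) × (Fin k → Fin m → ℝ)

variable (φ e) in
/-- The coordinates of a point of the phase space. -/
def phaseCoord (p : PhaseSpace k F E) : CoordSpace n m k :=
  (p.1, φ (phaseProj k F E p), fun A α => momentumCoord e A α p)

/-- The point of the phase space with given coordinates. -/
def phasePoint (he : IsLocalFrameOn (𝓡 n) F ∞ e φ.source) (z : CoordSpace n m k) :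
    PhaseSpace k F E := coordPoint he z.1 z.2.1 z.2.2

theorem phasePoint_phaseCoord (he : IsLocalFrameOn (𝓡 n) F ∞ e φ.source) {p : PhaseSpace k F E}
    (hp : phaseProj k F E p ∈ φ.source) : phasePoint he (phaseCoord φ e p) = p := by
  -- The base point of `coordPoint` is `φ.symm (φ q)`, equal to `q` but not by definition;
  -- generalising it avoids transport between fibres.
  have key : ∀ q', q' = p.2.proj → (⟨q', fibreCLM F q'
      (LinearMap.pi fun A => ∑ α, momentumCoord e A α p • he.coeff α q')⟩ :
        MomentumSpace k F E) = p.2 := by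
    rintro _ rfl
    refine TotalSpace.ext rfl (heq_of_eq ?_)
    ext a A
    rw [fibreCLM_apply]
    conv_rhs => rw [← he.sum_coeff_smul hp a]
    simp only [LinearMap.pi_apply, LinearMap.sum_apply, LinearMap.smul_apply, smul_eq_mul, map_sum,
      map_smul]
    rw [Finset.sum_apply]
    refine Finset.sum_congr rfl fun α _ => ?_
    rw [mul_comm]
    rfl
  exact Prod.ext rfl (key _ (φ.left_inv hp))

theorem momentumCoord_coordPoint (he : IsLocalFrameOn (𝓡 n) F ∞ e φ.source) (t : Fin k → ℝ)
    {x : EuclideanSpace ℝ (Fin n)} (hx : x ∈ φ.target) (y : Fin k → Fin m → ℝ) (A : Fin k)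
    (α : Fin m) : momentumCoord e A α (coordPoint he t x y) = y A α := by
  change fibreCLM F (φ.symm x) (LinearMap.pi fun A => ∑ α, y A α • he.coeff α (φ.symm x))
    (e α (φ.symm x)) A = _
  rw [fibreCLM_apply]
  simp [he.coeff_self (φ.map_target hx)]

theorem contMDiffOn_chart_coord (hφ : φ ∈ IsManifold.maximalAtlas (𝓡 n) ∞ Q) (i : Fin n) :
    ContMDiffOn (𝓡 n) 𝓘(ℝ, ℝ) ∞ (fun q => φ q i) φ.source :=
  ((EuclideanSpace.proj i : EuclideanSpace ℝ (Fin n) →L[ℝ] ℝ).contMDiff (n := ∞)).comp_contMDiffOn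
    (contMDiffOn_of_mem_maximalAtlas hφ)

theorem contMDiffAt_momentumCoord (he : IsLocalFrameOn (𝓡 n) F ∞ e φ.source)
    {p : PhaseSpace k F E} (hp : phaseProj k F E p ∈ φ.source) (A : Fin k) (α : Fin m) :
    ContMDiffAt (phaseModel k (𝓡 n) F) 𝓘(ℝ, ℝ) ∞ (momentumCoord (F := F) e A α) p :=
  contMDiffAt_covector_apply (he.contMDiffAt φ.open_source hp α) A

theorem contMDiffAt_phaseCoord (hφ : φ ∈ IsManifold.maximalAtlas (𝓡 n) ∞ Q)
    (he : IsLocalFrameOn (𝓡 n) F ∞ e φ.source) {p : PhaseSpace k F E}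
    (hp : phaseProj k F E p ∈ φ.source) :
    ContMDiffAt (phaseModel k (𝓡 n) F) 𝓘(ℝ, CoordSpace n m k) ∞ (phaseCoord (F := F) φ e) p := by
  refine ContMDiffAt.prodMk_space contMDiffAt_fst (ContMDiffAt.prodMk_space ?_ ?_)
  · exact ((contMDiffOn_of_mem_maximalAtlas hφ).contMDiffAt (φ.open_source.mem_nhds hp)).comp p
      (contMDiff_phaseProj p)
  · exact contMDiffAt_pi_space.2 fun A => contMDiffAt_pi_space.2 fun α =>
      contMDiffAt_momentumCoord he hp A α

theorem contMDiffAt_phasePoint (hφ : φ ∈ IsManifold.maximalAtlas (𝓡 n) ∞ Q)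
    (he : IsLocalFrameOn (𝓡 n) F ∞ e φ.source) {z : CoordSpace n m k} (hz : z.2.1 ∈ φ.target) :
    ContMDiffAt 𝓘(ℝ, CoordSpace n m k) (phaseModel k (𝓡 n) F) ∞
      (phasePoint (F := F) he) z := by
  have hfst : ContMDiffAt 𝓘(ℝ, CoordSpace n m k) 𝓘(ℝ, Fin k → ℝ) ∞
      (fun z : CoordSpace n m k => z.1) z := contDiff_fst.contMDiff.contMDiffAt
  have hx : ContMDiffAt 𝓘(ℝ, CoordSpace n m k) (𝓡 n) ∞
      (fun z : CoordSpace n m k => φ.symm z.2.1) z :=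
    ((contMDiffOn_symm_of_mem_maximalAtlas hφ).contMDiffAt (φ.open_target.mem_nhds hz)).comp z
      (contDiff_fst.comp contDiff_snd).contMDiff.contMDiffAt
  have hy : ∀ A α, ContMDiffAt 𝓘(ℝ, CoordSpace n m k) 𝓘(ℝ, ℝ) ∞
      (fun z : CoordSpace n m k => z.2.2 A α) z := fun A α => by
    refine ContDiff.contMDiff ?_ |>.contMDiffAt
    fun_prop
  -- In trivializations the covector part is a map into linear maps on `F`, tested on a fixed `v`.
  -- The vector `v` becomes a smooth local section of $E$, whose frame coefficients along `φ.symm`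
  -- are smooth.
  refine hfst.prodMk ((contMDiffAt_hom_bundle _).2 ⟨hx, contMDiffAt_clm_of_apply fun v => ?_⟩)
  let t := trivializationAt F E (φ.symm z.2.1)
  have hzt : φ.symm z.2.1 ∈ t.baseSet := mem_baseSet_trivializationAt F E _
  have hs : ContMDiffOn (𝓡 n) ((𝓡 n).prod 𝓘(ℝ, F)) ∞
      (fun q => TotalSpace.mk' F q (t.symmL ℝ q v)) t.baseSet := by
    rw [t.contMDiffOn_section_baseSet_iff]
    refine (contMDiffOn_const (c := v)).congr fun q hq => ?_
    simp [t.symmL_apply hq, t.apply_mk_symm hq]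
  have hs' : ContMDiffAt 𝓘(ℝ, CoordSpace n m k) ((𝓡 n).prod 𝓘(ℝ, F)) ∞
      (fun z : CoordSpace n m k => TotalSpace.mk' F (φ.symm z.2.1) (t.symmL ℝ (φ.symm z.2.1) v)) z :=
    ((hs.contMDiffAt (t.open_baseSet.mem_nhds hzt)).comp z hx)
  have hc := fun α => he.contMDiffAt_coeff_along φ.open_source
    (b := fun z : CoordSpace n m k => φ.symm z.2.1) (φ.map_target hz) hs' α
  have hsum : ContMDiffAt 𝓘(ℝ, CoordSpace n m k) 𝓘(ℝ, Fin k → ℝ) ∞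
      (fun z : CoordSpace n m k => fun A => ∑ α, z.2.2 A α *
        he.coeff α (φ.symm z.2.1) (t.symmL ℝ (φ.symm z.2.1) v)) z :=
    contMDiffAt_pi_space.2 fun A => ContMDiffAt.sum fun α _ => (hy A α).mul (hc α)
  refine hsum.congr_of_eventuallyEq (Filter.Eventually.of_forall fun z' => ?_)
  ext A
  simp only [ContinuousLinearMap.inCoordinates, ContinuousLinearMap.comp_apply]
  rw [fibreCLM_apply]
  simp [t]

end Coordinates

/-! ## Tangent vectors of the phase space in coordinates -/

section TangentCoordinates

variable {n : ℕ} {Q : Type*} [TopologicalSpace Q] [ChartedSpace (EuclideanSpace ℝ (Fin n)) Q]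
  [T2Space Q]
  {F : Type*} [NormedAddCommGroup F] [NormedSpace ℝ F] [FiniteDimensional ℝ F]
  {E : Q → Type*} [∀ q, AddCommGroup (E q)] [∀ q, Module ℝ (E q)] [∀ q, TopologicalSpace (E q)]
  [∀ q, IsTopologicalAddGroup (E q)] [∀ q, ContinuousSMul ℝ (E q)]
  [TopologicalSpace (TotalSpace F E)] [FiberBundle F E] [VectorBundle ℝ F E]
  [IsManifold (𝓡 n) ∞ Q] [ContMDiffVectorBundle ∞ F E (𝓡 n)]
  (L : LieAlgebroid (𝓡 n) F E) {k m : ℕ}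
  {φ : OpenPartialHomeomorph Q (EuclideanSpace ℝ (Fin n))}
  {e : Fin m → ∀ q, E q}

/-- The tangent vector at `p` with components `w` in the coordinates `(t^A, q^i, y_α^A)`. -/
def phaseTangent (he : IsLocalFrameOn (𝓡 n) F ∞ e φ.source) (p : PhaseSpace k F E)
    (w : CoordSpace n m k) : TangentSpace (phaseModel k (𝓡 n) F) p :=
  -- The derivative takes values in the tangent space at `phasePoint he (phaseCoord φ e p)`; this
  -- point is `p` when `p` lies over the chart.
  (mfderiv 𝓘(ℝ, CoordSpace n m k) (phaseModel k (𝓡 n) F) (phasePoint (F := F) he)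
    (phaseCoord φ e p) w :)

/-- The components of a tangent vector in the coordinates `(t^A, q^i, y_α^A)`. -/
def tangentCoord (φ : OpenPartialHomeomorph Q (EuclideanSpace ℝ (Fin n))) (e : Fin m → ∀ q, E q)
    (p : PhaseSpace k F E) (v : TangentSpace (phaseModel k (𝓡 n) F) p) : CoordSpace n m k :=
  (fun C => dirDeriv (fun p' : PhaseSpace k F E => p'.1 C) p v,
    WithLp.toLp 2 fun i => dirDeriv (fun p' : PhaseSpace k F E => φ (phaseProj k F E p') i) p v,
    fun A α => dirDeriv (momentumCoord (F := F) e A α) p v)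

theorem dirDeriv_phaseTangent (hφ : φ ∈ IsManifold.maximalAtlas (𝓡 n) ∞ Q)
    (he : IsLocalFrameOn (𝓡 n) F ∞ e φ.source) {p : PhaseSpace k F E}
    (hp : phaseProj k F E p ∈ φ.source) {g : PhaseSpace k F E → ℝ}
    (hg : MDifferentiableAt (phaseModel k (𝓡 n) F) 𝓘(ℝ, ℝ) g p) (w : CoordSpace n m k) :
    dirDeriv g p (phaseTangent he p w) =
      fderiv ℝ (fun z => g (phasePoint he z)) (phaseCoord φ e p) w := by
  have hd : MDifferentiableAt 𝓘(ℝ, CoordSpace n m k) (phaseModel k (𝓡 n) F)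
      (phasePoint (F := F) he) (phaseCoord φ e p) :=
    (contMDiffAt_phasePoint hφ he (φ.map_source hp)).mdifferentiableAt (by simp)
  have hpp := phasePoint_phaseCoord he hp
  have h := dirDeriv_comp (f := g) (by rwa [hpp]) hd w
  rw [dirDeriv_eq_fderiv] at h
  rw [h]
  unfold phaseTangent dirDeriv
  rw [hpp]

/-- Each component is recovered by composing with a linear coordinate functional and applying the
chain rule. -/
theorem mfderiv_phaseCoord (hφ : φ ∈ IsManifold.maximalAtlas (𝓡 n) ∞ Q)
    (he : IsLocalFrameOn (𝓡 n) F ∞ e φ.source) {p : PhaseSpace k F E}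
    (hp : phaseProj k F E p ∈ φ.source) (v : TangentSpace (phaseModel k (𝓡 n) F) p) :
    mfderiv (phaseModel k (𝓡 n) F) 𝓘(ℝ, CoordSpace n m k) (phaseCoord (F := F) φ e) p v =
      tangentCoord φ e p v := by
  have hd : MDifferentiableAt (phaseModel k (𝓡 n) F) 𝓘(ℝ, CoordSpace n m k)
      (phaseCoord (F := F) φ e) p :=
    (contMDiffAt_phaseCoord hφ he hp).mdifferentiableAt (by simp)
  have key : ∀ l : CoordSpace n m k →L[ℝ] ℝ, dirDeriv (fun p' => l (phaseCoord φ e p')) p v =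
      l (mfderiv (phaseModel k (𝓡 n) F) 𝓘(ℝ, CoordSpace n m k) (phaseCoord (F := F) φ e) p v :) := by
    intro l
    have h := dirDeriv_comp (f := l) l.differentiableAt.mdifferentiableAt hd v
    refine h.trans ((dirDeriv_eq_fderiv _).trans ?_)
    rw [l.fderiv]
  refine Prod.ext (funext fun C => ?_) (Prod.ext (PiLp.ext fun i => ?_)
    (funext fun A => funext fun α => ?_))
  · exact (key ((ContinuousLinearMap.proj C).comp (ContinuousLinearMap.fst ℝ _ _))).symm
  · exact (key ((EuclideanSpace.proj i).comp ((ContinuousLinearMap.fst ℝ _ _).comp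
      (ContinuousLinearMap.snd ℝ _ _)))).symm
  · exact (key ((ContinuousLinearMap.proj α : (Fin m → ℝ) →L[ℝ] ℝ).comp
      ((ContinuousLinearMap.proj A : (Fin k → Fin m → ℝ) →L[ℝ] (Fin m → ℝ)).comp
      ((ContinuousLinearMap.snd ℝ _ _).comp (ContinuousLinearMap.snd ℝ _ _))))).symm

/-- Chain rule for `phasePoint he ∘ phaseCoord φ e`, which is the identity near `p`. -/
theorem phaseTangent_tangentCoord (hφ : φ ∈ IsManifold.maximalAtlas (𝓡 n) ∞ Q)
    (he : IsLocalFrameOn (𝓡 n) F ∞ e φ.source) {p : PhaseSpace k F E}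
    (hp : phaseProj k F E p ∈ φ.source) (v : TangentSpace (phaseModel k (𝓡 n) F) p) :
    phaseTangent he p (tangentCoord φ e p v) = v := by
  have hd : MDifferentiableAt (phaseModel k (𝓡 n) F) 𝓘(ℝ, CoordSpace n m k)
      (phaseCoord (F := F) φ e) p :=
    (contMDiffAt_phaseCoord hφ he hp).mdifferentiableAt (by simp)
  have hd' : MDifferentiableAt 𝓘(ℝ, CoordSpace n m k) (phaseModel k (𝓡 n) F)
      (phasePoint (F := F) he) (phaseCoord φ e p) :=
    (contMDiffAt_phasePoint hφ he (φ.map_source hp)).mdifferentiableAt (by simp)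
  have h1 := (hd'.hasMFDerivAt.comp p hd.hasMFDerivAt)
  have h2 : phasePoint (F := F) he ∘ phaseCoord φ e =ᶠ[𝓝 p] id := by
    filter_upwards [(contMDiff_phaseProj (I := 𝓡 n) (F := F) (E := E) (k := k)).continuous.continuousAt.preimage_mem_nhds
      (φ.open_source.mem_nhds hp)] with x hx
    exact phasePoint_phaseCoord he hx
  have h3 := (h1.congr_of_eventuallyEq h2.symm).mfderiv
  rw [← mfderiv_phaseCoord hφ he hp]
  have h4 := congrArg (fun l : TangentSpace (phaseModel k (𝓡 n) F) p →L[ℝ]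
    TangentSpace (phaseModel k (𝓡 n) F) p => l v) (h3.symm.trans mfderiv_id)
  exact h4

/-- Tangent vectors with the same components are equal. -/
theorem eq_of_tangentCoord_eq (hφ : φ ∈ IsManifold.maximalAtlas (𝓡 n) ∞ Q)
    (he : IsLocalFrameOn (𝓡 n) F ∞ e φ.source) {p : PhaseSpace k F E}
    (hp : phaseProj k F E p ∈ φ.source) {v w : TangentSpace (phaseModel k (𝓡 n) F) p}
    (h : tangentCoord φ e p v = tangentCoord φ e p w) : v = w := by
  rw [← phaseTangent_tangentCoord hφ he hp v, h, phaseTangent_tangentCoord hφ he hp]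

theorem tangentCoord_phaseTangent (hφ : φ ∈ IsManifold.maximalAtlas (𝓡 n) ∞ Q)
    (he : IsLocalFrameOn (𝓡 n) F ∞ e φ.source) {p : PhaseSpace k F E}
    (hp : phaseProj k F E p ∈ φ.source) (w : CoordSpace n m k) :
    tangentCoord φ e p (phaseTangent he p w) = w := by
  have hd := (contMDiffAt_phaseCoord hφ he hp).mdifferentiableAt (by simp)
  have key : ∀ (l : CoordSpace n m k →L[ℝ] ℝ),
      dirDeriv (fun p' => l (phaseCoord (F := F) φ e p')) p (phaseTangent he p w) = l w := by
    intro l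
    have hl : MDifferentiableAt (phaseModel k (𝓡 n) F) 𝓘(ℝ, ℝ)
        (fun p' => l (phaseCoord (F := F) φ e p')) p :=
      MDifferentiableAt.comp (I' := 𝓘(ℝ, CoordSpace n m k)) p
        l.differentiableAt.mdifferentiableAt hd
    rw [dirDeriv_phaseTangent hφ he hp hl]
    have heq : (fun z => l (phaseCoord φ e (phasePoint (F := F) he z))) =ᶠ[𝓝 (phaseCoord φ e p)]
        l := by
      have hc : Continuous fun z : CoordSpace n m k => z.2.1 := by fun_prop
      filter_upwards [hc.continuousAt.preimage_mem_nhds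
        (φ.open_target.mem_nhds (φ.map_source hp))] with z hz
      congr 1
      refine Prod.ext rfl (Prod.ext (φ.right_inv hz) (funext fun A => funext fun α => ?_))
      exact momentumCoord_coordPoint he _ hz _ _ _
    rw [heq.fderiv_eq, l.fderiv]
  refine Prod.ext (funext fun C => ?_) (Prod.ext (PiLp.ext fun i => ?_)
    (funext fun A => funext fun α => ?_))
  · exact key ((ContinuousLinearMap.proj C).comp (ContinuousLinearMap.fst ℝ _ _))
  · exact key ((EuclideanSpace.proj i).comp ((ContinuousLinearMap.fst ℝ _ _).comp
      (ContinuousLinearMap.snd ℝ _ _)))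
  · exact key ((ContinuousLinearMap.proj α : (Fin m → ℝ) →L[ℝ] ℝ).comp
      ((ContinuousLinearMap.proj A : (Fin k → Fin m → ℝ) →L[ℝ] (Fin m → ℝ)).comp
      ((ContinuousLinearMap.snd ℝ _ _).comp (ContinuousLinearMap.snd ℝ _ _))))

theorem dirDeriv_chart_mfderiv_phaseProj (hφ : φ ∈ IsManifold.maximalAtlas (𝓡 n) ∞ Q)
    {p : PhaseSpace k F E} (hp : phaseProj k F E p ∈ φ.source)
    (v : TangentSpace (phaseModel k (𝓡 n) F) p) (i : Fin n) :
    dirDeriv (fun q => φ q i) (phaseProj k F E p)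
      (mfderiv (phaseModel k (𝓡 n) F) (𝓡 n) (phaseProj k F E) p v) =
      dirDeriv (fun p' : PhaseSpace k F E => φ (phaseProj k F E p') i) p v :=
  (dirDeriv_comp (((contMDiffOn_chart_coord hφ i).contMDiffAt
    (φ.open_source.mem_nhds hp)).mdifferentiableAt (by simp))
    ((contMDiff_phaseProj p).mdifferentiableAt (by simp)) v).symm

/-- Tangent vectors on the base with the same components in a chart are equal. -/
theorem eq_of_dirDeriv_chart_eq (hφ : φ ∈ IsManifold.maximalAtlas (𝓡 n) ∞ Q) {q : Q}
    (hq : q ∈ φ.source) {v w : TangentSpace (𝓡 n) q}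
    (h : ∀ i, dirDeriv (fun q => φ q i) q v = dirDeriv (fun q => φ q i) q w) : v = w := by
  have hd : MDifferentiableAt (𝓡 n) 𝓘(ℝ, EuclideanSpace ℝ (Fin n)) φ q :=
    ((contMDiffOn_of_mem_maximalAtlas hφ).contMDiffAt
      (φ.open_source.mem_nhds hq)).mdifferentiableAt (by simp)
  have hd' : MDifferentiableAt 𝓘(ℝ, EuclideanSpace ℝ (Fin n)) (𝓡 n) φ.symm (φ q) :=
    ((contMDiffOn_symm_of_mem_maximalAtlas hφ).contMDiffAt
      (φ.open_target.mem_nhds (φ.map_source hq))).mdifferentiableAt (by simp)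
  have hcomp : ∀ u : TangentSpace (𝓡 n) q, ∀ i, dirDeriv (fun q => φ q i) q u =
      EuclideanSpace.proj (𝕜 := ℝ) i (mfderiv (𝓡 n) 𝓘(ℝ, EuclideanSpace ℝ (Fin n)) φ q u) := by
    intro u i
    have h := dirDeriv_comp (f := (EuclideanSpace.proj i : EuclideanSpace ℝ (Fin n) →L[ℝ] ℝ))
      (ContinuousLinearMap.differentiableAt _).mdifferentiableAt hd u
    refine h.trans ((dirDeriv_eq_fderiv _).trans ?_)
    rw [ContinuousLinearMap.fderiv]
  have hvw : mfderiv (𝓡 n) 𝓘(ℝ, EuclideanSpace ℝ (Fin n)) φ q v =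
      mfderiv (𝓡 n) 𝓘(ℝ, EuclideanSpace ℝ (Fin n)) φ q w :=
    PiLp.ext fun i => (hcomp v i).symm.trans ((h i).trans (hcomp w i))
  refine eq_of_dirDeriv_eq fun f hf => ?_
  -- Near `q` a function is a function of `φ`, so its derivative along a vector depends only on the
  -- chart components of that vector.
  have hfe : f =ᶠ[𝓝 q] fun x => (fun y => f (φ.symm y)) (φ x) := by
    filter_upwards [φ.open_source.mem_nhds hq] with x hx
    exact congrArg f (φ.left_inv hx).symm
  have hfd : MDifferentiableAt 𝓘(ℝ, EuclideanSpace ℝ (Fin n)) 𝓘(ℝ, ℝ) (fun y => f (φ.symm y))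
      (φ q) := MDifferentiableAt.comp (I' := 𝓡 n) _ ((hf _).mdifferentiableAt (by simp)) hd'
  rw [dirDeriv_congr hfe, dirDeriv_congr hfe, dirDeriv_comp hfd hd, dirDeriv_comp hfd hd, hvw]

end TangentCoordinates

/-! ## Differentials of `1`-sections on the phase space -/

section PhaseDifferential

variable {n : ℕ} {Q : Type*} [TopologicalSpace Q] [ChartedSpace (EuclideanSpace ℝ (Fin n)) Q]
  [T2Space Q]
  {F : Type*} [NormedAddCommGroup F] [NormedSpace ℝ F] [FiniteDimensional ℝ F]
  {E : Q → Type*} [∀ q, AddCommGroup (E q)] [∀ q, Module ℝ (E q)] [∀ q, TopologicalSpace (E q)]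
  [∀ q, IsTopologicalAddGroup (E q)] [∀ q, ContinuousSMul ℝ (E q)]
  [TopologicalSpace (TotalSpace F E)] [FiberBundle F E] [VectorBundle ℝ F E]
  [IsManifold (𝓡 n) ∞ Q] [ContMDiffVectorBundle ∞ F E (𝓡 n)]
  (L : LieAlgebroid (𝓡 n) F E) {k m : ℕ}
  {φ : OpenPartialHomeomorph Q (EuclideanSpace ℝ (Fin n))}
  {e : Fin m → ∀ q, E q}

theorem mfderiv_phaseProj_phaseTangent (hφ : φ ∈ IsManifold.maximalAtlas (𝓡 n) ∞ Q)
    (he : IsLocalFrameOn (𝓡 n) F ∞ e φ.source) {p : PhaseSpace k F E}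
    (hp : phaseProj k F E p ∈ φ.source) {w : CoordSpace n m k}
    {u : TangentSpace (𝓡 n) (phaseProj k F E p)}
    (hw : ∀ i, w.2.1 i = dirDeriv (fun q => φ q i) (phaseProj k F E p) u) :
    mfderiv (phaseModel k (𝓡 n) F) (𝓡 n) (phaseProj k F E) p (phaseTangent he p w) = u := by
  refine eq_of_dirDeriv_chart_eq hφ hp fun i => ?_
  rw [dirDeriv_chart_mfderiv_phaseProj hφ hp, ← hw]
  exact congrArg (fun z : CoordSpace n m k => z.2.1 i) (tangentCoord_phaseTangent hφ he hp w)

/-- The field is the tangent map of `phasePoint` applied to the smooth map `p ↦ (phaseCoord φ e p, w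
p)`. -/
theorem contMDiffOn_phaseTangent (hφ : φ ∈ IsManifold.maximalAtlas (𝓡 n) ∞ Q)
    (he : IsLocalFrameOn (𝓡 n) F ∞ e φ.source) {w : PhaseSpace k F E → CoordSpace n m k}
    (hw : ContMDiffOn (phaseModel k (𝓡 n) F) 𝓘(ℝ, CoordSpace n m k) ∞ w
      (phaseProj k F E ⁻¹' φ.source)) :
    ContMDiffOn (phaseModel k (𝓡 n) F) (phaseModel k (𝓡 n) F).tangent ∞
      (fun p => (⟨p, phaseTangent he p (w p)⟩ :
        TangentBundle (phaseModel k (𝓡 n) F) (PhaseSpace k F E)))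
      (phaseProj k F E ⁻¹' φ.source) := by
  have : IsManifold (phaseModel k (𝓡 n) F) 1 (PhaseSpace k F E) :=
    IsManifold.of_le (n := ∞) (by simp)
  let D : Set (CoordSpace n m k) := (fun z => z.2.1) ⁻¹' φ.target
  have hD : IsOpen D := φ.open_target.preimage (by fun_prop)
  have h1 : ContMDiffOn 𝓘(ℝ, CoordSpace n m k) (phaseModel k (𝓡 n) F) ∞
      (phasePoint (F := F) (k := k) he) D :=
    fun z hz => (contMDiffAt_phasePoint hφ he hz).contMDiffWithinAt
  have h2 := h1.contMDiffOn_tangentMapWithin (m := ∞) (by simp) hD.uniqueMDiffOn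
  have h3 : ContMDiffOn (phaseModel k (𝓡 n) F) 𝓘(ℝ, CoordSpace n m k).tangent ∞
      (fun p => (⟨phaseCoord (F := F) φ e p, w p⟩ :
        TangentBundle 𝓘(ℝ, CoordSpace n m k) (CoordSpace n m k)))
      (phaseProj k F E ⁻¹' φ.source) := by
    intro p hp
    refine contMDiffWithinAt_totalSpace.2
      ⟨(contMDiffAt_phaseCoord hφ he hp).contMDiffWithinAt, ?_⟩
    refine (hw p hp).congr (fun x _ => ?_) ?_ <;> simp
  refine (h2.comp h3 fun p hp => φ.map_source hp).congr fun p hp => ?_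
  simp only [Function.comp, tangentMapWithin]
  rw [mfderivWithin_of_isOpen hD (φ.map_source hp)]
  exact TotalSpace.ext (phasePoint_phaseCoord he hp).symm HEq.rfl

/-- The $E$-part of `z` extends to a global section `σ`. The tangent part extends with constant $t$
and $y$ components, while the $q$ components are forced to be those of $\rho(\sigma)$; at `p` they
are the given ones because `z` lies in the prolongation. Such sections allow the Koszul formula to
be evaluated on arbitrary elements. -/
theorem exists_isProjectableOn (hφ : φ ∈ IsManifold.maximalAtlas (𝓡 n) ∞ Q)
    (he : IsLocalFrameOn (𝓡 n) F ∞ e φ.source) {p : PhaseSpace k F E}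
    (hp : phaseProj k F E p ∈ φ.source)
    (z : ProlongFiber L (phaseModel k (𝓡 n) F) (phaseProj k F E) p) :
    ∃ Z : PreSection (𝓡 n) F E (phaseModel k (𝓡 n) F) (PhaseSpace k F E),
      IsProjectableOn L (phaseModel k (𝓡 n) F) (phaseProj k F E) Z
        (phaseProj k F E ⁻¹' φ.source) ∧ Z.1 (phaseProj k F E p) = z.1.1 ∧ Z.2 p = z.1.2 := by
  obtain ⟨σ, hσ⟩ := exists_contMDiffSection_apply_eq (I := 𝓡 n) (F := F) _ z.1.1
  have hz : L.anchor (phaseProj k F E p) z.1.1 =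
    mfderiv (phaseModel k (𝓡 n) F) (𝓡 n) (phaseProj k F E) p z.1.2 := z.2
  let ρ : Q → EuclideanSpace ℝ (Fin n) := fun q =>
    WithLp.toLp 2 fun i => dirDeriv (fun q => φ q i) q (L.anchor q (σ q))
  let w : PhaseSpace k F E → CoordSpace n m k := fun p' =>
    ((tangentCoord φ e p z.1.2).1, ρ (phaseProj k F E p'), (tangentCoord φ e p z.1.2).2.2)
  have hρ : ContMDiffOn (𝓡 n) 𝓘(ℝ, EuclideanSpace ℝ (Fin n)) ∞ ρ φ.source := by
    have h : ContMDiffOn (𝓡 n) 𝓘(ℝ, Fin n → ℝ) ∞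
        (fun q i => dirDeriv (fun q => φ q i) q (L.anchor q (σ q))) φ.source :=
      contMDiffOn_pi_space.2 fun i => (contMDiffOn_chart_coord hφ i).dirDeriv φ.open_source
        (L.contMDiff_anchor σ).contMDiffOn
    exact ((PiLp.continuousLinearEquiv 2 ℝ (fun _ : Fin n => ℝ)).symm.contDiff.contMDiff
      (n := ∞)).comp_contMDiffOn h
  have hw : ContMDiffOn (phaseModel k (𝓡 n) F) 𝓘(ℝ, CoordSpace n m k) ∞ w
      (phaseProj k F E ⁻¹' φ.source) :=
    contMDiffOn_const.prodMk_space ((hρ.comp contMDiff_phaseProj.contMDiffOn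
      (fun _ h => h)).prodMk_space contMDiffOn_const)
  refine ⟨(σ, fun p' => phaseTangent he p' (w p')), ⟨contMDiffOn_phaseTangent hφ he hw,
    fun p' hp' => (mfderiv_phaseProj_phaseTangent hφ he hp' fun i => rfl).symm⟩, hσ, ?_⟩
  have hwp : w p = tangentCoord φ e p z.1.2 := by
    refine Prod.ext rfl (Prod.ext (PiLp.ext fun i => ?_) rfl)
    change dirDeriv _ _ (L.anchor _ (σ _)) = dirDeriv _ _ _
    rw [hσ, hz, dirDeriv_chart_mfderiv_phaseProj hφ hp]
  change phaseTangent he p (w p) = _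
  rw [hwp, phaseTangent_tangentCoord hφ he hp]

theorem exists_isProjectableOn_eval (hφ : φ ∈ IsManifold.maximalAtlas (𝓡 n) ∞ Q)
    (he : IsLocalFrameOn (𝓡 n) F ∞ e φ.source) {p : PhaseSpace k F E}
    (hp : phaseProj k F E p ∈ φ.source)
    (z : ProlongFiber L (phaseModel k (𝓡 n) F) (phaseProj k F E) p) :
    ∃ Z : PreSection (𝓡 n) F E (phaseModel k (𝓡 n) F) (PhaseSpace k F E),
      IsProjectableOn L (phaseModel k (𝓡 n) F) (phaseProj k F E) Z
        (phaseProj k F E ⁻¹' φ.source) ∧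
      Z.eval L (phaseModel k (𝓡 n) F) (phaseProj k F E) p = z := by
  obtain ⟨Z, hZ, h1, h2⟩ := exists_isProjectableOn L hφ he hp z
  refine ⟨Z, hZ, Subtype.ext ?_⟩
  rw [hZ.coe_eval hp, h1, h2]

variable (F) in
theorem isOpen_preimage_phaseProj (φ : OpenPartialHomeomorph Q (EuclideanSpace ℝ (Fin n))) :
    IsOpen (phaseProj k F E ⁻¹' φ.source) :=
  φ.open_source.preimage (contMDiff_phaseProj (I := 𝓡 n)).continuous

/-- The differential of the `1`-section defined by a family of functionals, in a local frame. -/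
theorem ProlongForm.d_ofFunctional_apply (hφ : φ ∈ IsManifold.maximalAtlas (𝓡 n) ∞ Q)
    (he : IsLocalFrameOn (𝓡 n) F ∞ e φ.source) {p : PhaseSpace k F E}
    (hp : phaseProj k F E p ∈ φ.source) {ℓ : ∀ p : PhaseSpace k F E, E (phaseProj k F E p) →L[ℝ] ℝ}
    (hℓ : SmoothFunctional (phaseModel k (𝓡 n) F) (𝓡 n) F ℓ) {g : Fin m → Cₛ^∞⟮𝓡 n; F, E⟯}
    (hg : ∀ i, ∀ᶠ x in 𝓝 (phaseProj k F E p), g i x = e i x)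
    (z : Fin 2 → ProlongFiber L (phaseModel k (𝓡 n) F) (phaseProj k F E) p) :
    (ProlongForm.ofFunctional L (IM := phaseModel k (𝓡 n) F) ℓ).d L p z =
      ∑ i, (he.coeff i _ (z 1).1.1 * dirDeriv (fun x => ℓ x (g i (phaseProj k F E x))) p (z 0).1.2 -
        he.coeff i _ (z 0).1.1 * dirDeriv (fun x => ℓ x (g i (phaseProj k F E x))) p (z 1).1.2) -
      ∑ i, ∑ j, he.coeff i _ (z 0).1.1 * he.coeff j _ (z 1).1.1 *
        ℓ p (L.bracket (g i) (g j) (phaseProj k F E p)) := by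
  choose Z hZ hz using fun i => exists_isProjectableOn_eval L hφ he hp (z i)
  have hV := isOpen_preimage_phaseProj (k := k) (E := E) F φ
  have hd := ProlongForm.d_isExtDeriv L
    (ProlongForm.exists_isExtDeriv_ofFunctional L contMDiff_phaseProj hℓ) p _ Z hV hp hZ
  have hpair : ∀ i, ((Z i).1 (phaseProj k F E p), (Z i).2 p) = (z i).1 := fun i => by
    rw [← (hZ i).coe_eval hp, hz]
  have h1 : ∀ i, (Z i).1 (phaseProj k F E p) = (z i).1.1 := fun i => congrArg Prod.fst (hpair i)
  have h2 : ∀ i, (Z i).2 p = (z i).1.2 := fun i => congrArg Prod.snd (hpair i)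
  simp only [hz] at hd
  rw [hd, ProlongForm.koszul_ofFunctional L contMDiff_phaseProj ℓ hV hp hZ,
    hℓ.koszul_eq L contMDiff_phaseProj (he.isGermFrame φ.open_source hp hg) _ _ _ _
      ((hZ 0).2 p hp) ((hZ 1).2 p hp)]
  simp only [he.coeffL_apply, h1, h2]

theorem KProlongForm.d_ofFunctional_apply (hφ : φ ∈ IsManifold.maximalAtlas (𝓡 n) ∞ Q)
    (he : IsLocalFrameOn (𝓡 n) F ∞ e φ.source) {p : PhaseSpace k F E}
    (hp : phaseProj k F E p ∈ φ.source) {ℓ : ∀ p : PhaseSpace k F E, E (phaseProj k F E p) →L[ℝ] ℝ}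
    (hℓ : SmoothFunctional (phaseModel k (𝓡 n) F) (𝓡 n) F ℓ) (A : Fin k)
    (z : Fin 2 → HFiber L k p) :
    (KProlongForm.ofFunctional L (IM := phaseModel k (𝓡 n) F) A ℓ).d L A p z =
      (ProlongForm.ofFunctional L (IM := phaseModel k (𝓡 n) F) ℓ).d L p fun i => z i A := by
  choose Z hZ hz using fun i B => exists_isProjectableOn_eval L hφ he hp (z i B)
  have hV := isOpen_preimage_phaseProj (k := k) (E := E) F φ
  have hd := ProlongForm.d_isExtDeriv L
    (ProlongForm.exists_isExtDeriv_ofFunctional L contMDiff_phaseProj hℓ) p _ (fun i => Z i A) hV hp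
    fun i => hZ i A
  have hK := KProlongForm.d_isExtDeriv L
    (KProlongForm.exists_isExtDeriv_ofFunctional L contMDiff_phaseProj A hℓ) p _ Z hV hp hZ
  rw [KProlongForm.koszul_ofFunctional, ← hd] at hK
  simpa only [hz] using hK

theorem liouville_eq_ofFunctional (A : Fin k) :
    liouville L A = KProlongForm.ofFunctional L A (fun p => covector p A) := rfl

/-- The Liouville `2`-section in local coordinates. -/
theorem liouvilleOmega_apply (hφ : φ ∈ IsManifold.maximalAtlas (𝓡 n) ∞ Q)
    (he : IsLocalFrameOn (𝓡 n) F ∞ e φ.source) {C : Fin m → Fin m → Fin m → Q → ℝ}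
    (hC : IsStructureFunctions L e φ.source C) {p : PhaseSpace k F E}
    (hp : phaseProj k F E p ∈ φ.source) (A : Fin k) (z : Fin 2 → HFiber L k p) :
    liouvilleOmega L A p z =
      ∑ i, (he.coeff i _ (z 0 A).1.1 * dirDeriv (momentumCoord (F := F) e A i) p (z 1 A).1.2 -
        he.coeff i _ (z 1 A).1.1 * dirDeriv (momentumCoord (F := F) e A i) p (z 0 A).1.2) +
      ∑ i, ∑ j, he.coeff i _ (z 0 A).1.1 * he.coeff j _ (z 1 A).1.1 *
        ∑ γ, C i j γ (phaseProj k F E p) * momentumCoord e A γ p := by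
  obtain ⟨g, hg⟩ := he.exists_germ_extension φ.open_source hp
  have hmom : ∀ i, (fun x : PhaseSpace k F E => covector x A (g i (phaseProj k F E x))) =ᶠ[𝓝 p]
      momentumCoord e A i := fun i => by
    filter_upwards [(contMDiff_phaseProj (I := 𝓡 n)).continuous.continuousAt.eventually (hg i)]
      with x hx
    rw [hx]
    rfl
  have hbr : ∀ i j, covector p A (L.bracket (g i) (g j) (phaseProj k F E p)) =
      ∑ γ, C i j γ (phaseProj k F E p) * momentumCoord e A γ p := fun i j => by
    rw [hC _ hp i j _ _ (hg i) (hg j), map_sum]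
    simp only [map_smul, smul_eq_mul]
    rfl
  change -((liouville L A).d L A p z) = _
  rw [liouville_eq_ofFunctional, KProlongForm.d_ofFunctional_apply L hφ he hp
    (smoothFunctional_covector A), ProlongForm.d_ofFunctional_apply L hφ he hp
    (smoothFunctional_covector A) hg]
  simp only [dirDeriv_congr (hmom _), hbr]
  rw [neg_sub, sub_eq_add_neg, add_comm, ← Finset.sum_neg_distrib]
  simp only [neg_sub]

/-! Partial derivatives of a function on the phase space. -/

/-- Freezing the other coordinates is composing with the affine inclusion `x ↦ (t, x, y)`, whose
derivative inserts zeros. -/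
theorem basePartial_eq (he : IsLocalFrameOn (𝓡 n) F ∞ e φ.source) {H : PhaseSpace k F E → ℝ}
    {p : PhaseSpace k F E}
    (hH : DifferentiableAt ℝ (fun z => H (phasePoint he z)) (phaseCoord φ e p)) (i : Fin n) :
    basePartial he H i p = fderiv ℝ (fun z => H (phasePoint he z)) (phaseCoord φ e p)
      (0, EuclideanSpace.single i 1, 0) := by
  have hid : HasFDerivAt (fun x : EuclideanSpace ℝ (Fin n) => x) (.id ℝ _)
    (φ (phaseProj k F E p)) := hasFDerivAt_id _
  have h1 : HasFDerivAt (fun x : EuclideanSpace ℝ (Fin n) =>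
      ((p.1, x, fun A α => momentumCoord e A α p) : CoordSpace n m k)) _
      (φ (phaseProj k F E p)) :=
    (hasFDerivAt_const p.1 _).prodMk (hid.prodMk (hasFDerivAt_const _ _))
  have h2 := (HasFDerivAt.comp (φ (phaseProj k F E p)) hH.hasFDerivAt h1).fderiv
  exact congrArg (fun l : EuclideanSpace ℝ (Fin n) →L[ℝ] ℝ => l (EuclideanSpace.single i 1)) h2

theorem momentumPartial_eq (he : IsLocalFrameOn (𝓡 n) F ∞ e φ.source) {H : PhaseSpace k F E → ℝ}
    {p : PhaseSpace k F E}
    (hH : DifferentiableAt ℝ (fun z => H (phasePoint he z)) (phaseCoord φ e p)) (A : Fin k)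
    (α : Fin m) :
    momentumPartial he H A α p = fderiv ℝ (fun z => H (phasePoint he z)) (phaseCoord φ e p)
      (0, 0, Pi.single A (Pi.single α 1)) := by
  have hid : HasFDerivAt (fun y : Fin k → Fin m → ℝ => y) (.id ℝ _)
    (fun A α => momentumCoord e A α p) := hasFDerivAt_id _
  have h1 : HasFDerivAt (fun y : Fin k → Fin m → ℝ =>
      ((p.1, φ (phaseProj k F E p), y) : CoordSpace n m k)) _
      (fun A α => momentumCoord e A α p) :=
    (hasFDerivAt_const p.1 _).prodMk ((hasFDerivAt_const _ _).prodMk hid)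
  have h2 := (HasFDerivAt.comp (fun A α => momentumCoord e A α p) hH.hasFDerivAt h1).fderiv
  exact congrArg (fun l : (Fin k → Fin m → ℝ) →L[ℝ] ℝ => l (Pi.single A (Pi.single α 1))) h2

end PhaseDifferential

/-! ## The Hamiltonian equations in local coordinates -/

section HamiltonCoordinates

variable {n : ℕ} {Q : Type*} [TopologicalSpace Q] [ChartedSpace (EuclideanSpace ℝ (Fin n)) Q]
  [T2Space Q]
  {F : Type*} [NormedAddCommGroup F] [NormedSpace ℝ F] [FiniteDimensional ℝ F]
  {E : Q → Type*} [∀ q, AddCommGroup (E q)] [∀ q, Module ℝ (E q)] [∀ q, TopologicalSpace (E q)]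
  [∀ q, IsTopologicalAddGroup (E q)] [∀ q, ContinuousSMul ℝ (E q)]
  [TopologicalSpace (TotalSpace F E)] [FiberBundle F E] [VectorBundle ℝ F E]
  [IsManifold (𝓡 n) ∞ Q] [ContMDiffVectorBundle ∞ F E (𝓡 n)]
  {L : LieAlgebroid (𝓡 n) F E} {k m : ℕ}
  {φ : OpenPartialHomeomorph Q (EuclideanSpace ℝ (Fin n))}
  {e : Fin m → ∀ q, E q}

theorem sum_anchorCoeff_mul_coeff (he : IsLocalFrameOn (𝓡 n) F ∞ e φ.source) {q : Q}
    (hq : q ∈ φ.source) (i : Fin n) (a : E q) :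
    ∑ α, anchorCoeff L φ e i α q * he.coeff α q a =
      dirDeriv (fun q => φ q i) q (L.anchor q a) := by
  conv_rhs => rw [← he.sum_coeff_smul hq a, map_sum, dirDeriv_sum_vec]
  refine Finset.sum_congr rfl fun α _ => ?_
  rw [map_smul, dirDeriv_smul_vec, mul_comm]
  rfl

/-- This is the defining relation $\rho(a)=T\pi(v)$ read in the chart. Applied to `ξ` it yields the
first Hamilton equation, and applied to `ψ` the anchor equation. -/
theorem sum_anchorCoeff_mul_coeff_prolong (hφ : φ ∈ IsManifold.maximalAtlas (𝓡 n) ∞ Q)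
    (he : IsLocalFrameOn (𝓡 n) F ∞ e φ.source) {p : PhaseSpace k F E}
    (hp : phaseProj k F E p ∈ φ.source) (i : Fin n)
    (z : ProlongFiber L (phaseModel k (𝓡 n) F) (phaseProj k F E) p) :
    ∑ α, anchorCoeff L φ e i α (phaseProj k F E p) * he.coeff α _ z.1.1 =
      dirDeriv (fun p' : PhaseSpace k F E => φ (phaseProj k F E p') i) p z.1.2 := by
  rw [sum_anchorCoeff_mul_coeff he hp, ← dirDeriv_chart_mfderiv_phaseProj hφ hp]
  have hz : L.anchor (phaseProj k F E p) z.1.1 =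
    mfderiv (phaseModel k (𝓡 n) F) (𝓡 n) (phaseProj k F E) p z.1.2 := z.2
  rw [hz]

/-- The element of the prolongation with components `a` and `w`. -/
theorem exists_prolong_phaseTangent (hφ : φ ∈ IsManifold.maximalAtlas (𝓡 n) ∞ Q)
    (he : IsLocalFrameOn (𝓡 n) F ∞ e φ.source) {p : PhaseSpace k F E}
    (hp : phaseProj k F E p ∈ φ.source) (a : E (phaseProj k F E p)) {w : CoordSpace n m k}
    (hw : ∀ i, w.2.1 i = dirDeriv (fun q => φ q i) (phaseProj k F E p) (L.anchor _ a)) :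
    ∃ z : ProlongFiber L (phaseModel k (𝓡 n) F) (phaseProj k F E) p,
      z.1 = (a, phaseTangent he p w) :=
  ⟨⟨(a, phaseTangent he p w), (mfderiv_phaseProj_phaseTangent hφ he hp hw).symm⟩, rfl⟩

theorem IsStructureFunctions.antisymm (he : IsLocalFrameOn (𝓡 n) F ∞ e φ.source)
    {C : Fin m → Fin m → Fin m → Q → ℝ} (hC : IsStructureFunctions L e φ.source C) {q : Q}
    (hq : q ∈ φ.source) (α β γ : Fin m) : C α β γ q = -C β α γ q := by
  obtain ⟨g, hg⟩ := he.exists_germ_extension φ.open_source hq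
  have h := congrArg (he.coeff γ q) (hC q hq α β _ _ (hg α) (hg β))
  rw [L.bracket_antisymm] at h
  have h' := congrArg (he.coeff γ q) (hC q hq β α _ _ (hg β) (hg α))
  rw [he.coeff_sum_smul hq (fun γ => C _ _ γ q)] at h h'
  rw [← h, ← h']
  exact map_neg _ _

theorem HamiltonEquations.summed {H : PhaseSpace k F E → ℝ}
    {ξ : KProlongSection L (phaseModel k (𝓡 n) F) (phaseProj k F E) k}
    (h : HamiltonEquations H ξ) : SummedHamiltonEquations H ξ :=
  ⟨h.1, fun p _ => Finset.sum_congr rfl fun A _ => h.2 A p _⟩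

theorem mdifferentiableAt_phasePoint (hφ : φ ∈ IsManifold.maximalAtlas (𝓡 n) ∞ Q)
    (he : IsLocalFrameOn (𝓡 n) F ∞ e φ.source) {H : PhaseSpace k F E → ℝ}
    (hH : ContMDiff (phaseModel k (𝓡 n) F) 𝓘(ℝ, ℝ) ∞ H) {p : PhaseSpace k F E}
    (hp : phaseProj k F E p ∈ φ.source) :
    DifferentiableAt ℝ (fun z => H (phasePoint he z)) (phaseCoord φ e p) :=
  (((hH _).comp _ (contMDiffAt_phasePoint hφ he
    (φ.map_source hp : (phaseCoord φ e p).2.1 ∈ φ.target))).mdifferentiableAt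
      (by simp)).differentiableAt

/-- The summed Hamiltonian equations, on elements without `∂/∂t` components. -/
theorem SummedHamiltonEquations.sum_liouvilleOmega (hk : 0 < k)
    (hφ : φ ∈ IsManifold.maximalAtlas (𝓡 n) ∞ Q)
    (he : IsLocalFrameOn (𝓡 n) F ∞ e φ.source) {H : PhaseSpace k F E → ℝ}
    (hH : ContMDiff (phaseModel k (𝓡 n) F) 𝓘(ℝ, ℝ) ∞ H)
    {ξ : KProlongSection L (phaseModel k (𝓡 n) F) (phaseProj k F E) k}
    (hξ : SummedHamiltonEquations H ξ) {p : PhaseSpace k F E}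
    (hp : phaseProj k F E p ∈ φ.source)
    (z : ProlongFiber L (phaseModel k (𝓡 n) F) (phaseProj k F E) p) {w : CoordSpace n m k}
    (hz : z.1.2 = phaseTangent he p w) (hw : w.1 = 0) :
    ∑ A, liouvilleOmega L A p ![ξ.val p, fun _ => z] =
      fderiv ℝ (fun z => H (phasePoint he z)) (phaseCoord φ e p) w := by
  have ht : ∀ A C, timeComponent L A C p (fun _ => z) = 0 := fun A C => by
    change dirDeriv _ p z.1.2 = 0
    rw [hz]
    refine (congrArg (fun z : CoordSpace n m k => z.1 C)
      (tangentCoord_phaseTangent hφ he hp w)).trans ?_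
    simp [hw]
  rw [hξ.2 p z]
  -- On a diagonal element $d^AH$ does not depend on $A$, so the sum is $k$ copies of $v(H)/k$; here
  -- $k\ne 0$ is used.
  simp only [hamiltonRHS, ht, mul_zero, Finset.sum_const_zero, sub_zero, dFun, Finset.sum_const,
    Finset.card_univ, Fintype.card_fin, nsmul_eq_mul]
  rw [← mul_assoc, mul_one_div_cancel (by positivity), one_mul, hz,
    dirDeriv_phaseTangent hφ he hp ((hH p).mdifferentiableAt (by simp))]

/-- The `E`-components of a solution of the summed Hamiltonian equations. -/
theorem SummedHamiltonEquations.coeff_eq (hk : 0 < k)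
    (hφ : φ ∈ IsManifold.maximalAtlas (𝓡 n) ∞ Q)
    (he : IsLocalFrameOn (𝓡 n) F ∞ e φ.source) {C : Fin m → Fin m → Fin m → Q → ℝ}
    (hC : IsStructureFunctions L e φ.source C) {H : PhaseSpace k F E → ℝ}
    (hH : ContMDiff (phaseModel k (𝓡 n) F) 𝓘(ℝ, ℝ) ∞ H)
    {ξ : KProlongSection L (phaseModel k (𝓡 n) F) (phaseProj k F E) k}
    (hξ : SummedHamiltonEquations H ξ) {p : PhaseSpace k F E}
    (hp : phaseProj k F E p ∈ φ.source) (B : Fin k) (β : Fin m) :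
    he.coeff β _ (ξ.val p B).1.1 = momentumPartial he H B β p := by
  classical
  -- The test element is $\mathcal V^\beta_B$. It differentiates only $y^B_\beta$, so a single term
  -- of the double sum over $A$ and the frame index survives.
  obtain ⟨z, hz⟩ := exists_prolong_phaseTangent (L := L) hφ he hp 0
    (w := (0, 0, Pi.single B (Pi.single β 1))) fun i => by
      rw [map_zero, dirDeriv_zero_vec]; rfl
  have h1 : z.1.1 = 0 := congrArg Prod.fst hz
  have h2 := congrArg Prod.snd hz
  have h := hξ.sum_liouvilleOmega hk hφ he hH hp z h2 rfl
  have hy : ∀ A α, dirDeriv (momentumCoord (F := F) e A α) p z.1.2 =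
      (Pi.single B (Pi.single β 1) : Fin k → Fin m → ℝ) A α := fun A α => by
    rw [h2]
    exact congrArg (fun z : CoordSpace n m k => z.2.2 A α) (tangentCoord_phaseTangent hφ he hp _)
  simp only [liouvilleOmega_apply L hφ he hC hp, Matrix.cons_val_zero, Matrix.cons_val_one, h1, hy,
    map_zero, zero_mul, mul_zero, sub_zero, Finset.sum_const_zero, add_zero] at h
  rw [momentumPartial_eq he (mdifferentiableAt_phasePoint hφ he hH hp), ← h]
  rw [Finset.sum_eq_single B, Finset.sum_eq_single β]
  · simp
  · intro b _ hb
    simp [hb]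
  · simp
  · intro b _ hb
    simp [hb]
  · simp

/-- The momentum components of a solution of the summed Hamiltonian equations. -/
theorem SummedHamiltonEquations.sum_dirDeriv_momentumCoord (hk : 0 < k)
    (hφ : φ ∈ IsManifold.maximalAtlas (𝓡 n) ∞ Q)
    (he : IsLocalFrameOn (𝓡 n) F ∞ e φ.source) {C : Fin m → Fin m → Fin m → Q → ℝ}
    (hC : IsStructureFunctions L e φ.source C) {H : PhaseSpace k F E → ℝ}
    (hH : ContMDiff (phaseModel k (𝓡 n) F) 𝓘(ℝ, ℝ) ∞ H)
    {ξ : KProlongSection L (phaseModel k (𝓡 n) F) (phaseProj k F E) k}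
    (hξ : SummedHamiltonEquations H ξ) {p : PhaseSpace k F E}
    (hp : phaseProj k F E p ∈ φ.source) (β : Fin m) :
    ∑ A, dirDeriv (momentumCoord (F := F) e A β) p (ξ.val p A).1.2 =
      -(∑ i, anchorCoeff L φ e i β (phaseProj k F E p) * basePartial he H i p +
        ∑ A, ∑ α, ∑ γ, C β α γ (phaseProj k F E p) * momentumCoord e A γ p *
          momentumPartial he H A α p) := by
  classical
  let ρ : EuclideanSpace ℝ (Fin n) :=
    WithLp.toLp 2 fun i => anchorCoeff L φ e i β (phaseProj k F E p)
  -- The test element is $\mathcal X_\beta$: it kills all $y^A_\alpha$, and its derivative of `H` is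
  -- $\rho^i_\beta\,\partial H/\partial q^i$.
  obtain ⟨z, hz⟩ := exists_prolong_phaseTangent (L := L) hφ he hp (e β _)
    (w := (0, ρ, 0)) fun i => rfl
  have h1 : z.1.1 = e β _ := congrArg Prod.fst hz
  have h2 := congrArg Prod.snd hz
  have h := hξ.sum_liouvilleOmega hk hφ he hH hp z h2 rfl
  have hy : ∀ A α, dirDeriv (momentumCoord (F := F) e A α) p z.1.2 = 0 := fun A α => by
    rw [h2]
    exact congrArg (fun z : CoordSpace n m k => z.2.2 A α) (tangentCoord_phaseTangent hφ he hp _)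
  have hρ : ((0, ρ, 0) : CoordSpace n m k) = ∑ i, anchorCoeff L φ e i β (phaseProj k F E p) •
      ((0, EuclideanSpace.single i 1, 0) : CoordSpace n m k) := by
    refine Prod.ext ?_ (Prod.ext (PiLp.ext fun j => ?_) ?_)
    · simp [Prod.fst_sum]
    · simp [Prod.snd_sum, Prod.fst_sum, ρ, Pi.single_apply]
    · simp [Prod.snd_sum]
  rw [hρ, map_sum] at h
  simp only [liouvilleOmega_apply L hφ he hC hp, Matrix.cons_val_zero, Matrix.cons_val_one, h1, hy,
    mul_zero, zero_sub, he.coeff_self hp, ite_mul, mul_ite, one_mul, mul_one, zero_mul,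
    Finset.sum_neg_distrib, Finset.sum_ite_eq, Finset.mem_univ, if_true, map_smul,
    smul_eq_mul, ← basePartial_eq he (mdifferentiableAt_phasePoint hφ he hH hp),
    hξ.coeff_eq hk hφ he hC hH hp, Finset.sum_add_distrib] at h
  -- With `ξ` in the first slot of $\Omega^A$ the structure functions appear as $\mathcal
  -- C^\gamma_{\alpha\beta}$; exchanging the lower indices gives the sign of the conclusion.
  have h3 : ∑ A, ∑ α, momentumPartial he H A α p * ∑ γ, C α β γ (phaseProj k F E p) *
        momentumCoord (F := F) e A γ p =
      -∑ A, ∑ α, ∑ γ, C β α γ (phaseProj k F E p) * momentumCoord e A γ p *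
          momentumPartial he H A α p := by
    simp only [← Finset.sum_neg_distrib, Finset.mul_sum]
    refine Finset.sum_congr rfl fun A _ => Finset.sum_congr rfl fun α _ =>
      Finset.sum_congr rfl fun γ _ => ?_
    rw [hC.antisymm he hp α β]
    ring
  rw [h3] at h
  linarith

end HamiltonCoordinates

/-! ## Morphisms from `Tℝᵏ` to the prolongation -/

theorem extDeriv_apply_zero_degree {V : Type*} [NormedAddCommGroup V] [NormedSpace ℝ V]
    {f : V → ℝ} {x : V} (hf : DifferentiableAt ℝ f x) (u : V) :
    extDeriv (fun x => ContinuousAlternatingMap.constOfIsEmpty ℝ V (Fin 0) (f x)) x ![u] =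
      fderiv ℝ f x u := by
  have h : DifferentiableAt ℝ
      (fun x => ContinuousAlternatingMap.constOfIsEmpty ℝ V (Fin 0) (f x)) x :=
    ((ContinuousAlternatingMap.constOfIsEmptyLIE ℝ V ℝ (Fin 0)).toContinuousLinearEquiv
      ).differentiableAt.comp x hf
  rw [extDeriv_apply h]
  simp

/-- `u` and `v` are constant fields on the source, so no bracket term occurs. -/
theorem extDeriv_apply_one_degree {V : Type*} [NormedAddCommGroup V] [NormedSpace ℝ V]
    {f : V → V →L[ℝ] ℝ} {x : V} (hf : DifferentiableAt ℝ f x) (u v : V) :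
    extDeriv (fun x => ContinuousAlternatingMap.ofSubsingleton ℝ V ℝ (0 : Fin 1) (f x)) x ![u, v] =
      fderiv ℝ (f · v) x u - fderiv ℝ (f · u) x v := by
  have h : DifferentiableAt ℝ
      (fun x => ContinuousAlternatingMap.ofSubsingleton ℝ V ℝ (0 : Fin 1) (f x)) x :=
    ((ContinuousAlternatingMap.ofSubsingletonLIE (𝕜 := ℝ) (E := V) (F := ℝ) (0 : Fin 1)).toContinuousLinearEquiv
      ).differentiableAt.comp x hf
  rw [extDeriv_apply h, Fin.sum_univ_two]
  simp [Fin.removeNth, sub_eq_add_neg]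

theorem differentiableAt_clm_of_apply {D V : Type*} [NormedAddCommGroup D] [NormedSpace ℝ D]
    [NormedAddCommGroup V] [NormedSpace ℝ V] [FiniteDimensional ℝ V] {f : D → V →L[ℝ] ℝ} {x : D}
    (hf : ∀ v, DifferentiableAt ℝ (fun x => f x v) x) : DifferentiableAt ℝ f x := by
  let b := Module.finBasis ℝ V
  have h : f = fun x => ∑ i, f x (b i) • LinearMap.toContinuousLinearMap (b.coord i) := by
    funext x
    ext v
    conv_lhs => rw [← b.sum_repr v, map_sum]
    simp [mul_comm]
  rw [h]
  fun_prop (disch := exact hf _)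

section Morphism

variable {n : ℕ} {Q : Type*} [TopologicalSpace Q] [ChartedSpace (EuclideanSpace ℝ (Fin n)) Q]
  [T2Space Q]
  {F : Type*} [NormedAddCommGroup F] [NormedSpace ℝ F] [FiniteDimensional ℝ F]
  {E : Q → Type*} [∀ q, AddCommGroup (E q)] [∀ q, Module ℝ (E q)] [∀ q, TopologicalSpace (E q)]
  [∀ q, IsTopologicalAddGroup (E q)] [∀ q, ContinuousSMul ℝ (E q)]
  [TopologicalSpace (TotalSpace F E)] [FiberBundle F E] [VectorBundle ℝ F E]
  [IsManifold (𝓡 n) ∞ Q] [ContMDiffVectorBundle ∞ F E (𝓡 n)]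
  {L : LieAlgebroid (𝓡 n) F E} {k m : ℕ}
  {φ : OpenPartialHomeomorph Q (EuclideanSpace ℝ (Fin n))}
  {e : Fin m → ∀ q, E q}
  (ψ : ProlongMorphism L (phaseModel k (𝓡 n) F) (phaseProj k F E) k)

theorem ProlongMorphism.fderiv_comp_base {f : PhaseSpace k F E → ℝ}
    {t : Fin k → ℝ} (hf : MDifferentiableAt (phaseModel k (𝓡 n) F) 𝓘(ℝ, ℝ) f (ψ.base t))
    (u : Fin k → ℝ) :
    fderiv ℝ (fun t => f (ψ.base t)) t u = dirDeriv f (ψ.base t)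
      (mfderiv 𝓘(ℝ, Fin k → ℝ) (phaseModel k (𝓡 n) F) ψ.base t u) := by
  rw [← dirDeriv_eq_fderiv]
  exact dirDeriv_comp hf ((ψ.base_smooth t).mdifferentiableAt (by simp)) u

/-- The pull-back of the differential of a function. -/
theorem ProlongMorphism.fderiv_comp_base_eq_map (hφ : φ ∈ IsManifold.maximalAtlas (𝓡 n) ∞ Q)
    (he : IsLocalFrameOn (𝓡 n) F ∞ e φ.source) {t : Fin k → ℝ}
    (ht : phaseProj k F E (ψ.base t) ∈ φ.source) {f : PhaseSpace k F E → ℝ}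
    (hf : ContMDiff (phaseModel k (𝓡 n) F) 𝓘(ℝ, ℝ) ∞ f) (u : Fin k → ℝ) :
    fderiv ℝ (fun t => f (ψ.base t)) t u = dirDeriv f (ψ.base t) (ψ.map t u).1.2 := by
  have h := congrArg (fun η => η t ![u])
    (ψ.pullback_d 0 (ProlongForm.ofFunction L f) (ProlongForm.smooth_ofFunction L hf))
  obtain ⟨Z, hZ, hz⟩ := exists_isProjectableOn_eval L hφ he ht (ψ.map t u)
  have hd := ProlongForm.d_isExtDeriv L (ProlongForm.exists_isExtDeriv_ofFunction L f) _ _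
    (fun _ => Z) (isOpen_preimage_phaseProj F φ) ht fun _ => hZ
  rw [koszul_zero_degree] at hd
  have h2 : Z.2 (ψ.base t) = (ψ.map t u).1.2 := by
    rw [← hz, hZ.coe_eval ht]
  have hdiff : DifferentiableAt ℝ (fun t => f (ψ.base t)) t :=
    ((hf.comp ψ.base_smooth).contDiff.differentiable (by simp)) t
  refine (extDeriv_apply_zero_degree hdiff u).symm.trans (h.trans ?_)
  rw [← h2]
  refine Eq.trans ?_ hd
  change (ProlongForm.ofFunction L f).d L (ψ.base t) (fun i => ψ.map t (![u] i)) = _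
  congr 1
  funext i
  rw [hz, Subsingleton.elim (α := Fin 1) i 0]
  rfl

/-- By the morphism condition in degree zero, both vectors act equally on global smooth functions.
This suffices to compare coordinates: $t^C$ is global, $q^i$ is cut off on the base, and
$y^A_\alpha$ has the germ of $b_A(\sigma)$ for a global section $\sigma$ extending the germ of
$e_\alpha$. -/
theorem ProlongMorphism.map_snd_eq_mfderiv (hφ : φ ∈ IsManifold.maximalAtlas (𝓡 n) ∞ Q)
    (he : IsLocalFrameOn (𝓡 n) F ∞ e φ.source) {t : Fin k → ℝ}
    (ht : phaseProj k F E (ψ.base t) ∈ φ.source) (u : Fin k → ℝ) :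
    (ψ.map t u).1.2 = mfderiv 𝓘(ℝ, Fin k → ℝ) (phaseModel k (𝓡 n) F) ψ.base t u := by
  have key : ∀ f : PhaseSpace k F E → ℝ, ContMDiff (phaseModel k (𝓡 n) F) 𝓘(ℝ, ℝ) ∞ f →
      dirDeriv f (ψ.base t) (ψ.map t u).1.2 = dirDeriv f (ψ.base t)
        (mfderiv 𝓘(ℝ, Fin k → ℝ) (phaseModel k (𝓡 n) F) ψ.base t u) := fun f hf => by
    rw [← ψ.fderiv_comp_base_eq_map hφ he ht hf,
      ψ.fderiv_comp_base ((hf _).mdifferentiableAt (by simp))]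
  have hproj := contMDiff_phaseProj (I := 𝓡 n) (F := F) (E := E) (k := k)
  refine eq_of_tangentCoord_eq hφ he ht (Prod.ext (funext fun C => ?_)
    (Prod.ext (PiLp.ext fun i => ?_) (funext fun A => funext fun α => ?_)))
  · exact key _ (((ContinuousLinearMap.proj C : (Fin k → ℝ) →L[ℝ] ℝ).contMDiff).comp
      contMDiff_fst)
  · obtain ⟨f, hf, hfφ⟩ := exists_contMDiff_eventuallyEq (I := 𝓡 n) φ.open_source ht
      (contMDiffOn_chart_coord hφ i)
    have h := key _ (hf.comp hproj)
    have hc : (f ∘ phaseProj k F E) =ᶠ[𝓝 (ψ.base t)] fun p' => φ (phaseProj k F E p') i :=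
      hproj.continuous.continuousAt.eventually hfφ
    rw [dirDeriv_congr hc, dirDeriv_congr hc] at h
    exact h
  · obtain ⟨g, hg⟩ := he.exists_germ_extension φ.open_source ht
    have h := key _ (smoothFunctional_covector A (g α))
    have hc : (fun p' : PhaseSpace k F E => covector p' A (g α (phaseProj k F E p')))
        =ᶠ[𝓝 (ψ.base t)] momentumCoord e A α := by
      filter_upwards [hproj.continuous.continuousAt.eventually (hg α)] with x hx
      rw [hx]
      rfl
    rw [dirDeriv_congr hc, dirDeriv_congr hc] at h
    exact h

/-- A coefficient in a local frame agrees near a point with a smooth family of functionals. -/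
theorem IsLocalFrameOn.exists_smoothFunctional_coeff (he : IsLocalFrameOn (𝓡 n) F ∞ e φ.source)
    {p : PhaseSpace k F E} (hp : phaseProj k F E p ∈ φ.source) (α : Fin m) :
    ∃ ℓ : ∀ p : PhaseSpace k F E, E (phaseProj k F E p) →L[ℝ] ℝ,
      SmoothFunctional (phaseModel k (𝓡 n) F) (𝓡 n) F ℓ ∧
      ∀ᶠ p' in 𝓝 p, phaseProj k F E p' ∈ φ.source ∧
        ∀ a, ℓ p' a = he.coeff α (phaseProj k F E p') a := by
  have hproj := contMDiff_phaseProj (I := 𝓡 n) (F := F) (E := E) (k := k)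
  obtain ⟨χ, hχ, hχ1, hχs⟩ := exists_contMDiff_bump (𝓡 n) (φ.open_source.mem_nhds hp)
  refine ⟨fun p => χ (phaseProj k F E p) • he.coeffL α (phaseProj k F E p), fun σ => ?_, ?_⟩
  · have h : ContMDiff (𝓡 n) 𝓘(ℝ, ℝ) ∞ fun q => χ q * he.coeff α q (σ q) := by
      refine contMDiff_of_tsupport fun q hq => ?_
      have hq' : q ∈ φ.source := hχs (closure_mono (Function.support_mul_subset_left χ _) hq)
      exact hχ.contMDiffAt.mul
        (he.contMDiffAt_coeff_along φ.open_source (b := id) hq' (σ.contMDiff q) α)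
    refine (h.comp hproj).congr fun p => ?_
    simp only [smul_apply, he.coeffL_apply, smul_eq_mul, Function.comp]
  · filter_upwards [hproj.continuous.continuousAt.eventually hχ1,
      (isOpen_preimage_phaseProj F φ).mem_nhds hp] with p hp hp'
    refine ⟨hp', fun a => ?_⟩
    have : χ (phaseProj k F E p) = 1 := hp
    simp only [smul_apply, he.coeffL_apply, smul_eq_mul, this, one_mul]

/-- The pull-back of the differential of a `1`-section. -/
theorem ProlongMorphism.fderiv_functional_sub
    {ℓ : ∀ p : PhaseSpace k F E, E (phaseProj k F E p) →L[ℝ] ℝ}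
    (hℓ : SmoothFunctional (phaseModel k (𝓡 n) F) (𝓡 n) F ℓ) {t : Fin k → ℝ}
    (hd : ∀ w, DifferentiableAt ℝ (fun s => ℓ (ψ.base s) (ψ.map s w).1.1) t)
    (u v : Fin k → ℝ) :
    fderiv ℝ (fun s => ℓ (ψ.base s) (ψ.map s v).1.1) t u -
      fderiv ℝ (fun s => ℓ (ψ.base s) (ψ.map s u).1.1) t v =
      (ProlongForm.ofFunctional L (IM := phaseModel k (𝓡 n) F) ℓ).d L (ψ.base t)
        ![ψ.map t u, ψ.map t v] := by
  let c : (Fin k → ℝ) → (Fin k → ℝ) →L[ℝ] ℝ := fun s =>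
    ((ℓ (ψ.base s)).comp ((ContinuousLinearMap.fst ℝ _ _).comp
      (ProlongFiber L (phaseModel k (𝓡 n) F) (phaseProj k F E) (ψ.base s)).subtypeL)).comp
        (ψ.map s)
  have hc : DifferentiableAt ℝ c t := differentiableAt_clm_of_apply hd
  have h := congrArg (fun η => η t ![u, v])
    (ψ.pullback_d 1 (ProlongForm.ofFunctional L ℓ) (ProlongForm.smooth_ofFunctional L hℓ))
  refine (extDeriv_apply_one_degree hc u v).symm.trans (h.trans ?_)
  change (ProlongForm.ofFunctional L ℓ).d L (ψ.base t) (fun i => ψ.map t (![u, v] i)) = _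
  congr 1
  funext i
  refine Fin.cases rfl (fun j => ?_) i
  rw [Subsingleton.elim (α := Fin 1) j 0]
  rfl

set_option maxHeartbeats 1000000 in
/-- The Maurer–Cartan equation for the `E`-components of a morphism. -/
theorem ProlongMorphism.fderiv_coeff_sub_fderiv_coeff
    (hφ : φ ∈ IsManifold.maximalAtlas (𝓡 n) ∞ Q) (he : IsLocalFrameOn (𝓡 n) F ∞ e φ.source)
    {C : Fin m → Fin m → Fin m → Q → ℝ} (hC : IsStructureFunctions L e φ.source C)
    {t : Fin k → ℝ} (ht : phaseProj k F E (ψ.base t) ∈ φ.source) (u v : Fin k → ℝ) (α : Fin m) :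
    fderiv ℝ (fun s => he.coeff α (phaseProj k F E (ψ.base s)) (ψ.map s v).1.1) t u -
      fderiv ℝ (fun s => he.coeff α (phaseProj k F E (ψ.base s)) (ψ.map s u).1.1) t v =
      -∑ β, ∑ γ, he.coeff β (phaseProj k F E (ψ.base t)) (ψ.map t u).1.1 * he.coeff γ (phaseProj k F E (ψ.base t)) (ψ.map t v).1.1 *
        C β γ α (phaseProj k F E (ψ.base t)) := by
  classical
  have hproj := contMDiff_phaseProj (I := 𝓡 n) (F := F) (E := E) (k := k)
  obtain ⟨g, hg⟩ := he.exists_germ_extension φ.open_source ht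
  obtain ⟨ℓ, hℓ'⟩ := he.exists_smoothFunctional_coeff ht α
  have hℓ := hℓ'.1
  have hℓ1 := hℓ'.2
  have hcw : ∀ w, (fun s => ℓ (ψ.base s) (ψ.map s w).1.1) =ᶠ[𝓝 t]
      fun s => he.coeff α (phaseProj k F E (ψ.base s)) (ψ.map s w).1.1 := fun w =>
    (ψ.base_smooth.continuous.continuousAt.eventually hℓ1).mono fun s hs => hs.2 _
  have hd : ∀ w, DifferentiableAt ℝ (fun s => ℓ (ψ.base s) (ψ.map s w).1.1) t := fun w =>
    ((he.contMDiffAt_coeff_along φ.open_source (b := fun s => phaseProj k F E (ψ.base s)) ht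
      (ψ.map_smooth_fst w t) α).contDiffAt.differentiableAt (by simp)).congr_of_eventuallyEq
        (hcw w)
  have h := ψ.fderiv_functional_sub hℓ hd u v
  rw [(hcw v).fderiv_eq, (hcw u).fderiv_eq] at h
  rw [h, ProlongForm.d_ofFunctional_apply L hφ he ht hℓ hg]
  -- Near the point `ℓ` is the dual coframe element $e^\alpha$, constant on the frame, so the
  -- derivative terms of its differential vanish and only structure functions remain.
  have hconst : ∀ i, (fun p => ℓ p (g i (phaseProj k F E p))) =ᶠ[𝓝 (ψ.base t)]
      fun _ => if i = α then 1 else 0 := fun i => by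
    filter_upwards [hℓ1, hproj.continuous.continuousAt.eventually (hg i)] with p hp hgp
    rw [hp.2, hgp, he.coeff_self hp.1]
  have hbr : ∀ i j, ℓ (ψ.base t) (L.bracket (g i) (g j) (phaseProj k F E (ψ.base t))) =
      C i j α (phaseProj k F E (ψ.base t)) := fun i j => by
    rw [hℓ1.self_of_nhds.2, hC _ ht i j _ _ (hg i) (hg j),
      he.coeff_sum_smul ht (fun γ => C i j γ (phaseProj k F E (ψ.base t)))]
  simp only [dirDeriv_congr (hconst _), dirDeriv_const, mul_zero, sub_zero,
    Finset.sum_const_zero, zero_sub, hbr, Matrix.cons_val_zero, Matrix.cons_val_one]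

end Morphism

end

/-! ### The field equations along an integral section -/

theorem mainTheorem7 {n m k : ℕ} (hk : 0 < k)
    {Q : Type*} [TopologicalSpace Q] [T2Space Q] [SecondCountableTopology Q]
    [ChartedSpace (EuclideanSpace ℝ (Fin n)) Q] [IsManifold (𝓡 n) ∞ Q]
    {E : Q → Type*} [∀ q, AddCommGroup (E q)] [∀ q, Module ℝ (E q)]
    [∀ q, TopologicalSpace (E q)] [∀ q, IsTopologicalAddGroup (E q)]
    [∀ q, ContinuousSMul ℝ (E q)] [TopologicalSpace (TotalSpace (Fin m → ℝ) E)]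
    [FiberBundle (Fin m → ℝ) E] [VectorBundle ℝ (Fin m → ℝ) E]
    [ContMDiffVectorBundle ∞ (Fin m → ℝ) E (𝓡 n)]
    (L : LieAlgebroid (𝓡 n) (Fin m → ℝ) E)
    (H : PhaseSpace k (Fin m → ℝ) E → ℝ)
    (hH : ContMDiff (phaseModel k (𝓡 n) (Fin m → ℝ)) 𝓘(ℝ, ℝ) ∞ H)
    (ξ : KProlongSection L (phaseModel k (𝓡 n) (Fin m → ℝ)) (phaseProj k (Fin m → ℝ) E) k)
    (hξ : HamiltonEquations H ξ ∨ SummedHamiltonEquations H ξ)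
    (ψ : ProlongMorphism L (phaseModel k (𝓡 n) (Fin m → ℝ)) (phaseProj k (Fin m → ℝ) E) k)
    (hψ : IsIntegralSection ξ ψ.base)
    (φ : OpenPartialHomeomorph Q (EuclideanSpace ℝ (Fin n)))
    (hφ : φ ∈ IsManifold.maximalAtlas (𝓡 n) ∞ Q)
    (e : Fin m → ∀ q, E q) (he : IsLocalFrameOn (𝓡 n) (Fin m → ℝ) ∞ e φ.source)
    (C : Fin m → Fin m → Fin m → Q → ℝ) (hC : IsStructureFunctions L e φ.source C)
    (t : Fin k → ℝ) (ht : phaseProj k (Fin m → ℝ) E (ψ.base t) ∈ φ.source) :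
    (∀ i A, partialT A (psiBase φ ψ i) t =
      ∑ α, anchorCoeff L φ e i α (phaseProj k (Fin m → ℝ) E (ψ.base t)) *
        momentumPartial he H A α (ψ.base t)) ∧
    (∀ β, ∑ A, partialT A (psiMomentum ψ e A β) t =
      -(∑ i, anchorCoeff L φ e i β (phaseProj k (Fin m → ℝ) E (ψ.base t)) *
          basePartial he H i (ψ.base t) +
        ∑ A, ∑ α, ∑ γ, C β α γ (phaseProj k (Fin m → ℝ) E (ψ.base t)) *
          psiMomentum ψ e A γ t * momentumPartial he H A α (ψ.base t))) ∧
    (∀ i A, ∑ α, anchorCoeff L φ e i α (phaseProj k (Fin m → ℝ) E (ψ.base t)) *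
        psiFibre ψ he α A t = partialT A (psiBase φ ψ i) t) ∧
    (∀ A B β, psiVertical ψ e B β A t = partialT A (psiMomentum ψ e B β) t) ∧
    (∀ α A B, 0 = partialT B (psiFibre ψ he α A) t - partialT A (psiFibre ψ he α B) t +
      ∑ β, ∑ γ, C β γ α (phaseProj k (Fin m → ℝ) E (ψ.base t)) *
        psiFibre ψ he β B t * psiFibre ψ he γ A t) := by
  have hS : SummedHamiltonEquations H ξ := hξ.elim HamiltonEquations.summed id
  have hφd : ∀ i, MDifferentiableAt (phaseModel k (𝓡 n) (Fin m → ℝ)) 𝓘(ℝ, ℝ)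
      (fun p' : PhaseSpace k (Fin m → ℝ) E => φ (phaseProj k (Fin m → ℝ) E p') i) (ψ.base t) :=
    fun i => (((contMDiffOn_chart_coord hφ i).contMDiffAt (φ.open_source.mem_nhds ht)).comp
      (ψ.base t) (contMDiff_phaseProj _)).mdifferentiableAt (by simp)
  have hmd : ∀ A α, MDifferentiableAt (phaseModel k (𝓡 n) (Fin m → ℝ)) 𝓘(ℝ, ℝ)
      (momentumCoord (F := Fin m → ℝ) e A α) (ψ.base t) :=
    fun A α => (contMDiffAt_momentumCoord he ht A α).mdifferentiableAt (by simp)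
  have hbase : ∀ i A, partialT A (psiBase φ ψ i) t = dirDeriv
      (fun p' : PhaseSpace k (Fin m → ℝ) E => φ (phaseProj k (Fin m → ℝ) E p') i) (ψ.base t)
      (mfderiv 𝓘(ℝ, Fin k → ℝ) (phaseModel k (𝓡 n) (Fin m → ℝ)) ψ.base t
        (Pi.single A 1 : Fin k → ℝ)) :=
    fun i A => ψ.fderiv_comp_base (hφd i) _
  have hmom : ∀ A B β, partialT A (psiMomentum ψ e B β) t = dirDeriv
      (momentumCoord (F := Fin m → ℝ) e B β) (ψ.base t)
      (mfderiv 𝓘(ℝ, Fin k → ℝ) (phaseModel k (𝓡 n) (Fin m → ℝ)) ψ.base t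
        (Pi.single A 1 : Fin k → ℝ)) :=
    fun A B β => ψ.fderiv_comp_base (hmd B β) _
  refine ⟨fun i A => ?_, fun β => ?_, fun i A => ?_, fun A B β => ?_, fun α A B => ?_⟩
  · rw [hbase, hψ.2, ← sum_anchorCoeff_mul_coeff_prolong hφ he ht i (ξ.val (ψ.base t) A)]
    simp only [hS.coeff_eq hk hφ he hC hH ht]
  · simp only [hmom, hψ.2]
    exact hS.sum_dirDeriv_momentumCoord hk hφ he hC hH ht β
  · rw [hbase, ← ψ.map_snd_eq_mfderiv hφ he ht]
    exact sum_anchorCoeff_mul_coeff_prolong hφ he ht i _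
  · rw [hmom, ← ψ.map_snd_eq_mfderiv hφ he ht]
    rfl
  · have h := ψ.fderiv_coeff_sub_fderiv_coeff hφ he hC ht (Pi.single B 1) (Pi.single A 1) α
    -- `h` identifies the difference of derivatives with minus the structure term; what remains is
    -- to match the order of the factors.
    refine (neg_add_cancel _).symm.trans (congrArg₂ (· + ·) h.symm ?_)
    refine Finset.sum_congr rfl fun β _ => Finset.sum_congr rfl fun γ _ => ?_
    rw [mul_comm, ← mul_assoc]
    rfl
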